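/- Let $\Gamma$ be a countable (discrete) abelian group acting by homeomorphisms on compact metrizable spaces $X$ and $Y$, and let $\pi\colon X\to Y$ be a factor map, i.e. a continuous $\Gamma$-equivariant surjection. Notation. For a finite open cover $\mathcal W$ of a space $Z$ put $\mathrm{ord}(\mathcal W)=\max_{z\in Z}\sum_{W\in\mathcal W}1_W(z)-1$, and for a finite open cover $\mathcal U$ of $Z$ let $\mathcal D(\mathcal U)$ be the minimum of $\mathrm{ord}(\mathcal W)$ over all finite open covers $\mathcal W$ of $Z$ such that every element of $\mathcal W$ is contained in an element of $\mathcal U$. For a finite open cover $\mathcal U$ of $X$, a nonempty finite set $F\subseteq\Gamma$ and a closed set $K\subseteq X$, let $\mathcal U^F=\bigvee_{s\in F}s^{-1}\mathcal U$ and $\mathcal U|_K=\{U\cap K: U\in\mathcal U\}$, a cover of the space $K$. Write $\lim_F\varphi(F)=c$ if for every $\varepsilon>0$ there are a nonempty finite $K\subseteq\Gamma$ and $\delta>0$ such that $|\varphi(F)-c|<\varepsilon$ for all nonempty finite $F\subseteq\Gamma$ with $|\{t\in F: Kt\subseteq F\}|\ge(1-\delta)|F|$. Let $M_\Gamma(Y)$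 be the set of $\Gamma$-invariant Borel probability measures on $Y$. For $\nu\in M_\Gamma(Y)$ define $$\mathcal D(\mathcal U|\nu)=\int_Y\mathcal D(\mathcal U|_{\pi^{-1}(y)})\,d\nu(y),\qquad \mathrm{mdim}(X|\nu)=\sup_{\mathcal U}\lim_F\frac{\mathcal D(\mathcal U^F|\nu)}{|F|},$$ where $\mathcal U$ ranges over all finite open covers of $X$. Let $(F_n)$ be a tiling Følner sequence of $\Gamma$: the $F_n$ are nonempty finite subsets with $|sF_n\,\Delta\,F_n|/|F_n|\to0$ for every $s\in\Gamma$, and for each $n$ there is $C_n\subseteq\Gamma$ such that $\{F_nc\}_{c\in C_n}$ is a partition of $\Gamma$. For closed $K\subseteq X$ define, along $(F_n)$, $$\mathrm{mdim}(K)=\sup_{\mathcal U}\limsup_{n\to\infty}\frac{\mathcal D(\mathcal U^{F_n}|_K)}{|F_n|}.$$ Then for all $\nu\in M_\Gamma(Y)$ and all finite open covers $\mathcal U$ of $X$ the limit $\lim_F\mathcal D(\mathcal U^F|\nu)/|F|$ exists and is finite, so that $\mathrm{mdim}(X|\nu)\in[0,\infty]$ is well defined, and $$\sup_{\nu\in M_\Gamma(Y)}\mathrm{mdim}(X|\nu)=\sup_{y\in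 Y}\mathrm{mdim}(\pi^{-1}(y)).$$ -/

import Mathlib

open Filter Topology MeasureTheory
open scoped ENNReal NNReal

namespace MeanDim

noncomputable section

/-! ### Finite open covers -/

/-- `W` is a finite open cover of the space `Z`. -/
structure IsFinOpenCover {Z : Type*} [TopologicalSpace Z] (W : Set (Set Z)) : Prop where
  finite : W.Finite
  isOpen : ∀ A ∈ W, IsOpen A
  covers : ⋃₀ W = Set.univ

/-- `W` refines `U`: every element of `W` is contained in some element of `U`. -/
def Refines {Z : Type*} (W U : Set (Set Z)) : Prop :=
  ∀ A ∈ W, ∃ B ∈ U, A ⊆ B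

/-- The overlapping number `max_x ∑_{A ∈ W} 1_A(x) - 1` of a finite cover. On a nonempty space
the maximum is at least `1`, so the subtraction in `ℕ` does not truncate. -/
def ord {Z : Type*} (W : Set (Set Z)) : ℕ :=
  (⨆ x : Z, {A ∈ W | x ∈ A}.ncard) - 1

/-- `𝒟(U)`: the least overlapping number of a finite open cover of `Z` that refines `U`. -/
def coverDim {Z : Type*} [TopologicalSpace Z] (U : Set (Set Z)) : ℕ :=
  sInf {n | ∃ W : Set (Set Z), IsFinOpenCover W ∧ Refines W U ∧ ord W = n}

/-- The restriction `U|_K = {A ∩ K : A ∈ U}`, as a family of subsets of the subspace `K`. -/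
def restrict {X : Type*} (U : Set (Set X)) (K : Set X) : Set (Set K) :=
  (fun A : Set X => (Subtype.val ⁻¹' A : Set K)) '' U

/-- `U^F = ⋁_{s ∈ F} s⁻¹ U`: its elements are the sets `⋂_{s ∈ F} s⁻¹ U_s` with all `U_s ∈ U`. -/
def coverPow {Γ X : Type*} [Group Γ] [MulAction Γ X] (U : Set (Set X)) (F : Finset Γ) :
    Set (Set X) :=
  {A | ∃ u : Γ → Set X, (∀ s ∈ F, u s ∈ U) ∧ A = ⋂ s ∈ F, (fun x : X => s • x) ⁻¹' u s}

/-! ### Følner sequences, tiles, and limits over increasingly invariant finite sets -/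

/-- `ℬ(K, δ)`: the nonempty finite `F` with `|{t ∈ F : K t ⊆ F}| ≥ (1 - δ)|F|`. -/
def almostInvariant {Γ : Type*} [Group Γ] (K : Finset Γ) (δ : ℝ) : Set (Finset Γ) :=
  {F | F.Nonempty ∧ (1 - δ) * (F.card : ℝ) ≤ ({t ∈ (F : Set Γ) | ∀ k ∈ K, k * t ∈ F}.ncard : ℝ)}

/-- The filter generated by the sets `ℬ(K, δ)`, `K` nonempty finite and `δ > 0`. Convergence along
it is convergence as `F` becomes more and more invariant. -/
def invFilter (Γ : Type*) [Group Γ] : Filter (Finset Γ) :=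
  ⨅ (K : Finset Γ) (_ : K.Nonempty) (δ : ℝ) (_ : 0 < δ), 𝓟 (almostInvariant K δ)

/-- Følner sequences of nonempty finite subsets: `|s Fₙ ∆ Fₙ| / |Fₙ| → 0` for every `s`. -/
structure IsFolnerSeq {Γ : Type*} [Group Γ] (F : ℕ → Finset Γ) : Prop where
  nonempty : ∀ n, (F n).Nonempty
  tendsto : ∀ s : Γ, Tendsto
    (fun n => ((symmDiff ((fun t => s * t) '' (F n : Set Γ)) (F n : Set Γ)).ncard : ℝ)
      / ((F n).card : ℝ)) atTop (𝓝 0)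

/-- `T` is a tile: for some set `C`, the translates `T c`, `c ∈ C`, partition the group. -/
def IsTile {Γ : Type*} [Group Γ] (T : Finset Γ) : Prop :=
  ∃ C : Set Γ, C.PairwiseDisjoint (fun c => (fun t => t * c) '' (T : Set Γ)) ∧
    (⋃ c ∈ C, (fun t => t * c) '' (T : Set Γ)) = Set.univ

/-- A tiling Følner sequence: a Følner sequence all of whose members are tiles. -/
structure IsTilingFolnerSeq {Γ : Type*} [Group Γ] (F : ℕ → Finset Γ) : Prop extends
    IsFolnerSeq F where
  isTile : ∀ n, IsTile (F n)

/-! ### Factor maps and mean dimensions -/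

/-- Factor maps: continuous equivariant surjections. -/
structure IsFactorMap (Γ : Type*) {X Y : Type*} [Group Γ] [TopologicalSpace X] [TopologicalSpace Y]
    [MulAction Γ X] [MulAction Γ Y] (π : X → Y) : Prop where
  continuous : Continuous π
  surjective : Function.Surjective π
  equivariant : ∀ (s : Γ) (x : X), π (s • x) = s • π x

/-- The mean dimension of a subset `K` of `X` along the sequence `F`:
`sup_U limsup_n 𝒟(U^{Fₙ}|_K) / |Fₙ|`, with `U` ranging over the finite open covers of `X`. -/
def mdimSubset {Γ X : Type*} [Group Γ] [TopologicalSpace X] [MulAction Γ X]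
    (F : ℕ → Finset Γ) (K : Set X) : ℝ≥0∞ :=
  ⨆ (U : Set (Set X)) (_ : IsFinOpenCover U),
    limsup (fun n => (coverDim (restrict (coverPow U (F n)) K) : ℝ≥0∞) / ((F n).card : ℝ≥0∞)) atTop

/-- `𝒟(U|ν) = ∫ 𝒟(U|_{π⁻¹(y)}) dν(y)`. -/
def coverDimGiven {X Y : Type*} [TopologicalSpace X] [MeasurableSpace Y]
    (π : X → Y) (ν : Measure Y) (U : Set (Set X)) : ℝ≥0∞ :=
  ∫⁻ y, (coverDim (restrict U (π ⁻¹' {y})) : ℝ≥0∞) ∂ν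

/-- The average `𝒟(U^F|ν) / |F|`. -/
def avgDimGiven {Γ X Y : Type*} [Group Γ] [TopologicalSpace X] [MulAction Γ X] [MeasurableSpace Y]
    (π : X → Y) (ν : Measure Y) (U : Set (Set X)) (F : Finset Γ) : ℝ≥0∞ :=
  coverDimGiven π ν (coverPow U F) / (F.card : ℝ≥0∞)

/-- The mean dimension `mdim(X|ν) = sup_U lim_F 𝒟(U^F|ν) / |F|` of `X` given `ν`. -/
def mdimGiven (Γ : Type*) {X Y : Type*} [Group Γ] [TopologicalSpace X] [MulAction Γ X]
    [MeasurableSpace Y] (π : X → Y) (ν : Measure Y) : ℝ≥0∞ :=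
  ⨆ (U : Set (Set X)) (_ : IsFinOpenCover U),
    limUnder (invFilter Γ) (fun F : Finset Γ => avgDimGiven π ν U F)

/-- The set of invariant Borel probability measures on `Y`. -/
def invariantProbabilities (Γ Y : Type*) [Group Γ] [MulAction Γ Y] [MeasurableSpace Y] :
    Set (Measure Y) :=
  {ν | IsProbabilityMeasure ν ∧ ∀ s : Γ, ν.map (fun y => s • y) = ν}

end

end MeanDim

/-! Write `d(y, E)` for `fiberDim π U y E`, the dimension of `U^E` on the fibre over `y`. It is
subadditive in `E`, satisfies `d(y, E s) = d(s y, E)`, is at most `|E| #U`, and is upper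
semicontinuous in `y` because `X` is compact. For invariant `ν` the integral of `d(·, E)` is
therefore subadditive and invariant under right translation, so its averages converge by the
Ornstein–Weiss lemma (`IsSubadditiveInvariant.exists_tendsto`), proved by quasi-tiling.

For `≤`, the limit may be computed along `F n`. Since `d(y, F n) / |F n|` is bounded by `#U`, the
reverse Fatou lemma moves the limsup inside the integral, where it is at most the mean dimension of
a fibre.

For `≥`, fix `y` and `ℓ` below the limsup of `d(y, F n) / |F n|`, and let `ν` be a weak limit, along
indices where `ℓ` is exceeded, of the uniform measures on `F n • y`; `ν` is invariant. For a tile `T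
= F m`, averaging over the `|T|` shifts of a tiling (`card_mul_fiberDim_le`) bounds `d(y, F n) / |F
n|` by the integral of `d(·, T) / |T|` against the `n`-th empirical measure, up to a boundary term.
Upper semicontinuity carries this to the limit, so `ℓ ≤ 𝒟(U^T|ν) / |T|` for every `m`, and `m → ∞`
gives the claim. -/

namespace MeanDim

/-! ### Open covers and their dimension -/

section Covers

variable {Z Z' : Type*} [TopologicalSpace Z] [TopologicalSpace Z']

/-- A finite indexed open cover refining `U` whose multiplicity is at most `k + 1` bounds the
dimension of `U` by `k`. -/
theorem coverDim_le_of_indexed {ι : Type*} [Finite ι] {U : Set (Set Z)} {k : ℕ} (V : ι → Set Z)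
    (hopen : ∀ i, IsOpen (V i)) (hcov : ∀ x, ∃ i, x ∈ V i) (href : ∀ i, ∃ B ∈ U, V i ⊆ B)
    (hmult : ∀ x, {i | x ∈ V i}.ncard ≤ k + 1) : coverDim U ≤ k := by
  have hW : IsFinOpenCover (Set.range V) := by
    refine ⟨Set.finite_range V, ?_, ?_⟩
    · rintro _ ⟨i, rfl⟩
      exact hopen i
    · refine Set.eq_univ_of_forall fun x => ?_
      obtain ⟨i, hi⟩ := hcov x
      exact ⟨V i, ⟨i, rfl⟩, hi⟩
  have hord : ord (Set.range V) ≤ k := by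
    unfold ord
    have : (⨆ x : Z, {A ∈ Set.range V | x ∈ A}.ncard) ≤ k + 1 := by
      rcases isEmpty_or_nonempty Z with h | h
      · simp
      · refine ciSup_le fun x => le_trans ?_ (hmult x)
        have : {A ∈ Set.range V | x ∈ A} = V '' {i | x ∈ V i} := by
          ext A
          constructor
          · rintro ⟨⟨i, rfl⟩, hx⟩
            exact ⟨i, hx, rfl⟩
          · rintro ⟨i, hx, rfl⟩
            exact ⟨⟨i, rfl⟩, hx⟩
        rw [this]
        exact Set.ncard_image_le (Set.toFinite _)
    omega
  have hmem : ord (Set.range V) ∈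
      {n | ∃ W : Set (Set Z), IsFinOpenCover W ∧ Refines W U ∧ ord W = n} := by
    refine ⟨Set.range V, hW, ?_, rfl⟩
    rintro _ ⟨i, rfl⟩
    exact href i
  exact (Nat.sInf_le hmem).trans hord

/-- A finite open cover has a refinement of multiplicity at most `coverDim U + 1`. -/
theorem IsFinOpenCover.exists_refinement {U : Set (Set Z)} (hU : IsFinOpenCover U) :
    ∃ W : Set (Set Z), IsFinOpenCover W ∧ Refines W U ∧
      ∀ x, {i : W | x ∈ i.1}.ncard ≤ coverDim U + 1 := by
  have hne : {n | ∃ W : Set (Set Z), IsFinOpenCover W ∧ Refines W U ∧ ord W = n}.Nonempty :=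
    ⟨_, U, hU, fun A hA => ⟨A, hA, subset_rfl⟩, rfl⟩
  obtain ⟨W, hW, href, hord⟩ := Nat.sInf_mem hne
  refine ⟨W, hW, href, fun x => ?_⟩
  have hbdd : BddAbove (Set.range fun x : Z => {A ∈ W | x ∈ A}.ncard) :=
    ⟨W.ncard, by
      rintro _ ⟨z, rfl⟩
      exact Set.ncard_le_ncard (Set.sep_subset _ _) hW.finite⟩
  have h1 : {A ∈ W | x ∈ A}.ncard ≤ ord W + 1 := by
    have := le_ciSup hbdd x
    unfold ord
    omega
  have h2 : {i : W | x ∈ i.1}.ncard = {A ∈ W | x ∈ A}.ncard := by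
    rw [← Set.ncard_image_of_injective _ Subtype.val_injective]
    congr 1
    ext A
    simp [and_comm]
  rw [h2]
  unfold coverDim
  omega

/-- The dimension does not increase under pull-back along continuous maps. -/
theorem coverDim_le_of_continuous {U : Set (Set Z)} {U' : Set (Set Z')} (hU' : IsFinOpenCover U')
    {f : Z → Z'} (hf : Continuous f) (h : ∀ B ∈ U', ∃ A ∈ U, f ⁻¹' B ⊆ A) :
    coverDim U ≤ coverDim U' := by
  obtain ⟨W, hW, href, hm⟩ := hU'.exists_refinement
  have := hW.finite.to_subtype
  refine coverDim_le_of_indexed (fun i : W => f ⁻¹' i.1) (fun i => (hW.isOpen _ i.2).preimage hf)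
    (fun x => ?_) (fun i => ?_) (fun x => hm (f x))
  · have hx : f x ∈ ⋃₀ W := hW.covers ▸ Set.mem_univ _
    obtain ⟨A, hA, hxA⟩ := hx
    exact ⟨⟨A, hA⟩, hxA⟩
  · obtain ⟨B, hB, hiB⟩ := href _ i.2
    obtain ⟨A, hA, hBA⟩ := h B hB
    exact ⟨A, hA, (Set.preimage_mono hiB).trans hBA⟩

/-- Every open set of a metrizable space is the set where some continuous function is positive. -/
theorem exists_continuous_pos_iff [TopologicalSpace.MetrizableSpace Z] {O : Set Z}
    (hO : IsOpen O) : ∃ f : Z → ℝ≥0∞, Continuous f ∧ ∀ x, 0 < f x ↔ x ∈ O := by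
  let _ := TopologicalSpace.metrizableSpaceMetric Z
  refine ⟨fun x => Metric.infEDist x Oᶜ, Metric.continuous_infEDist, fun x => ?_⟩
  rw [← not_iff_not, ← Set.mem_compl_iff, not_lt, nonpos_iff_eq_zero]
  exact (Metric.mem_iff_infEDist_zero_of_closed hO.isClosed_compl).symm

/-- The set of points at which `S` is a superlevel set of the family `h`, at a level at which
all members of `S` are positive. -/
def superlevelSet {ι Z : Type*} (h : ι → Z → ℝ≥0∞) (S : Finset ι) : Set Z :=
  {x | ∀ i ∈ S, 0 < h i x ∧ ∀ j ∉ S, h j x < h i x}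

theorem isOpen_superlevelSet {ι : Type*} [Finite ι] {h : ι → Z → ℝ≥0∞}
    (hh : ∀ i, Continuous (h i)) (S : Finset ι) : IsOpen (superlevelSet h S) := by
  have : superlevelSet h S =
      ⋂ i ∈ S, ({x | 0 < h i x} ∩ ⋂ j ∈ {j | j ∉ S}, {x | h j x < h i x}) := by
    ext x
    simp [superlevelSet]
  rw [this]
  refine isOpen_biInter_finset fun i _ => (isOpen_lt continuous_const (hh i)).inter ?_
  exact (Set.toFinite _).isOpen_biInter fun j _ => isOpen_lt (hh j) (hh i)

/-- The superlevel sets of the single function `i ↦ h i x` form a chain under inclusion, so their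
cardinalities tell them apart. -/
theorem superlevelSet_card_injOn {ι Z : Type*} (h : ι → Z → ℝ≥0∞) (x : Z) :
    Set.InjOn Finset.card {S : Finset ι | x ∈ superlevelSet h S} := by
  intro S hS T hT hST
  have key : ∀ {S T : Finset ι}, x ∈ superlevelSet h S → x ∈ superlevelSet h T →
      S.card = T.card → S ⊆ T := by
    intro S T hS hT hST i hi
    by_contra hiT
    have hTS : T ⊆ S := by
      intro j hj
      by_contra hjS
      exact lt_asymm ((hS i hi).2 j hjS) ((hT j hj).2 i hiT)
    rw [Finset.eq_of_subset_of_card_le hTS hST.le] at hiT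
    exact hiT hi
  exact subset_antisymm (key hS hT hST) (key hT hS hST.symm)

/-- Subadditivity of the dimension under joins. -/
theorem coverDim_le_add [TopologicalSpace.MetrizableSpace Z] {U U₁ U₂ : Set (Set Z)}
    (h₁ : IsFinOpenCover U₁) (h₂ : IsFinOpenCover U₂)
    (h : ∀ A ∈ U₁, ∀ B ∈ U₂, ∃ C ∈ U, A ∩ B ⊆ C) :
    coverDim U ≤ coverDim U₁ + coverDim U₂ := by
  classical
  obtain ⟨W₁, hW₁, href₁, hm₁⟩ := h₁.exists_refinement
  obtain ⟨W₂, hW₂, href₂, hm₂⟩ := h₂.exists_refinement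
  have := hW₁.finite.to_subtype
  have := hW₂.finite.to_subtype
  have := Fintype.ofFinite W₁
  have := Fintype.ofFinite W₂
  choose f hf hf' using fun i : W₁ => exists_continuous_pos_iff (hW₁.isOpen _ i.2)
  choose g hg hg' using fun i : W₂ => exists_continuous_pos_iff (hW₂.isOpen _ i.2)
  let H : W₁ ⊕ W₂ → Z → ℝ≥0∞ := Sum.elim f g
  have hH : ∀ i, Continuous (H i) := by
    rintro (i | i)
    exacts [hf i, hg i]
  -- Pairwise intersections of `W₁` and `W₂` could have multiplicity `(d₁ + 1) (d₂ + 1)`. Instead,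
  -- superlevel sets of the disjoint union of the two families are used, as in a barycentric
  -- subdivision of the join of the nerves. Those indexed by an `S` meeting both families lie in
  -- some `A ∩ B`.
  let J := {S : Finset (W₁ ⊕ W₂) // (∃ a, Sum.inl a ∈ S) ∧ ∃ b, Sum.inr b ∈ S}
  refine coverDim_le_of_indexed (fun S : J => superlevelSet H S.1)
    (fun S => isOpen_superlevelSet hH S.1) (fun x => ?_) ?_ (fun x => ?_)
  · have hx₁ : x ∈ ⋃₀ W₁ := hW₁.covers ▸ Set.mem_univ _
    have hx₂ : x ∈ ⋃₀ W₂ := hW₂.covers ▸ Set.mem_univ _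
    obtain ⟨A, hA, hxA⟩ := hx₁
    obtain ⟨B, hB, hxB⟩ := hx₂
    refine ⟨⟨Finset.univ.filter fun i => 0 < H i x, ⟨⟨A, hA⟩, ?_⟩, ⟨⟨B, hB⟩, ?_⟩⟩, ?_⟩
    · simpa [H] using (hf' ⟨A, hA⟩ x).2 hxA
    · simpa [H] using (hg' ⟨B, hB⟩ x).2 hxB
    · intro i hi
      simp only [Finset.mem_filter, Finset.mem_univ, true_and] at hi ⊢
      exact ⟨hi, fun j hj => (not_lt.1 hj).trans_lt hi⟩
  · rintro ⟨S, ⟨a, ha⟩, ⟨b, hb⟩⟩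
    obtain ⟨A, hA, haA⟩ := href₁ _ a.2
    obtain ⟨B, hB, hbB⟩ := href₂ _ b.2
    obtain ⟨C, hC, hABC⟩ := h A hA B hB
    refine ⟨C, hC, fun x hx => hABC ⟨haA ?_, hbB ?_⟩⟩
    · exact (hf' a x).1 (hx _ ha).1
    · exact (hg' b x).1 (hx _ hb).1
  · have hsupp : ∀ S : Finset (W₁ ⊕ W₂), x ∈ superlevelSet H S →
        S.card ≤ coverDim U₁ + coverDim U₂ + 2 := by
      intro S hS
      have hsub : (S : Set (W₁ ⊕ W₂)) ⊆
          Sum.inl '' {i : W₁ | x ∈ i.1} ∪ Sum.inr '' {i : W₂ | x ∈ i.1} := by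
        rintro (i | i) hi
        · exact Or.inl ⟨i, (hf' i x).1 (hS _ hi).1, rfl⟩
        · exact Or.inr ⟨i, (hg' i x).1 (hS _ hi).1, rfl⟩
      calc S.card = (S : Set (W₁ ⊕ W₂)).ncard := (Set.ncard_coe_finset S).symm
        _ ≤ _ := Set.ncard_le_ncard hsub (Set.toFinite _)
        _ ≤ _ := Set.ncard_union_le _ _
        _ ≤ (coverDim U₁ + 1) + (coverDim U₂ + 1) :=
          add_le_add ((Set.ncard_image_le (Set.toFinite _)).trans (hm₁ x))
            ((Set.ncard_image_le (Set.toFinite _)).trans (hm₂ x))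
        _ = _ := by ring
    -- The sets containing `x` have distinct cardinalities. Meeting both families forces cardinality
    -- at least `2`, which leaves `d₁ + d₂ + 1` values: exactly dimension `d₁ + d₂`.
    have hle : {S : J | x ∈ superlevelSet H S.1}.ncard ≤
        (Finset.Icc 2 (coverDim U₁ + coverDim U₂ + 2) : Set ℕ).ncard := by
      refine Set.ncard_le_ncard_of_injOn (fun S : J => S.1.card) ?_ ?_ (Set.toFinite _)
      · rintro ⟨S, ⟨a, ha⟩, ⟨b, hb⟩⟩ hS
        simp only [Finset.coe_Icc, Set.mem_Icc]
        exact ⟨Finset.one_lt_card.2 ⟨_, ha, _, hb, by simp⟩, hsupp S hS⟩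
      · intro S hS T hT hST
        exact Subtype.ext (superlevelSet_card_injOn H x hS hT hST)
    rw [Set.ncard_coe_finset, Nat.card_Icc] at hle
    exact hle.trans (by omega)

theorem IsFinOpenCover.restrict {U : Set (Set Z)} (hU : IsFinOpenCover U) (K : Set Z) :
    IsFinOpenCover (restrict U K) := by
  refine ⟨hU.finite.image _, ?_, ?_⟩
  · rintro _ ⟨A, hA, rfl⟩
    exact (hU.isOpen A hA).preimage continuous_subtype_val
  · refine Set.eq_univ_of_forall fun x => ?_
    have hx : x.1 ∈ ⋃₀ U := hU.covers ▸ Set.mem_univ _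
    obtain ⟨A, hA, hxA⟩ := hx
    exact ⟨_, ⟨A, hA, rfl⟩, hxA⟩

/-- The dimension of the fibres of a map from a compact metrizable space is upper
semicontinuous. -/
theorem isOpen_coverDim_fiber_le [CompactSpace Z] [TopologicalSpace.MetrizableSpace Z] [T2Space Z']
    {π : Z → Z'} (hπ : Continuous π) {U : Set (Set Z)} (hU : IsFinOpenCover U) (k : ℕ) :
    IsOpen {y | coverDim (MeanDim.restrict U (π ⁻¹' {y})) ≤ k} := by
  rw [isOpen_iff_mem_nhds]
  intro y hy
  obtain ⟨W, hW, href, hm⟩ := (hU.restrict (π ⁻¹' {y})).exists_refinement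
  have := hW.finite.to_subtype
  have hO : ∀ i : W, ∃ O : Set Z, IsOpen O ∧ Subtype.val ⁻¹' O = i.1 ∧ ∃ A ∈ U, O ⊆ A := by
    intro i
    obtain ⟨O, hO, hOi⟩ := isOpen_induced_iff.1 (hW.isOpen _ i.2)
    obtain ⟨_, ⟨A, hA, rfl⟩, hiA⟩ := href _ i.2
    refine ⟨O ∩ A, hO.inter (hU.isOpen A hA), ?_, A, hA, Set.inter_subset_right⟩
    rw [Set.preimage_inter, hOi]
    exact Set.inter_eq_left.2 hiA
  choose O hO hOi A hA hOA using hO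
  choose f hf hf' using fun i : W => exists_continuous_pos_iff (hO i)
  have hK : IsCompact (π ⁻¹' {y}) := (isClosed_singleton.preimage hπ).isCompact
  obtain ⟨n, hn⟩ := hK.elim_directed_cover (fun n : ℕ => ⋃ i, {x | (n : ℝ≥0∞)⁻¹ < f i x})
    (fun n => isOpen_iUnion fun i => isOpen_lt continuous_const (hf i))
    (by
      intro x hx
      have hx' : (⟨x, hx⟩ : π ⁻¹' {y}) ∈ ⋃₀ W := hW.covers ▸ Set.mem_univ _
      obtain ⟨B, hB, hxB⟩ := hx'
      have hpos : 0 < f ⟨B, hB⟩ x := by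
        rw [hf']
        have : (⟨x, hx⟩ : π ⁻¹' {y}) ∈ Subtype.val ⁻¹' (O ⟨B, hB⟩) := (hOi ⟨B, hB⟩).symm ▸ hxB
        exact this
      obtain ⟨n, hn⟩ := ENNReal.exists_inv_nat_lt hpos.ne'
      exact Set.mem_iUnion.2 ⟨n, Set.mem_iUnion.2 ⟨_, hn⟩⟩)
    (Monotone.directed_le fun m n hmn => Set.iUnion_mono fun i x hx =>
      lt_of_le_of_lt (ENNReal.inv_le_inv.2 (by exact_mod_cast hmn)) hx)
  set η : ℝ≥0∞ := (n : ℝ≥0∞)⁻¹ with hη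
  have hη0 : 0 < η := ENNReal.inv_pos.2 (ENNReal.natCast_ne_top n)
  -- The bad set: points missed by the shrunken sets `{η < f i}`, or lying in `k + 2` of the sets
  -- `{η ≤ f i}`. The non-strict inequality makes it closed, so its image is compact and misses a
  -- neighbourhood of `y`; over that neighbourhood the sets `{η < f i}` cover with multiplicity at
  -- most `k + 1`.
  let B : Set Z := (⋃ i, {x | η < f i x})ᶜ ∪
    ⋃ S ∈ {S : Set W | k + 2 ≤ S.ncard}, ⋂ i ∈ S, {x | η ≤ f i x}
  have hB : IsClosed B := by
    refine (isOpen_iUnion fun i => isOpen_lt continuous_const (hf i)).isClosed_compl.union ?_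
    refine (Set.toFinite _).isClosed_biUnion fun S _ => ?_
    exact isClosed_biInter fun i _ => isClosed_le continuous_const (hf i)
  have hyB : y ∉ π '' B := by
    rintro ⟨x, hx | hx, hxy⟩
    · exact hx (hn hxy)
    · simp only [Set.mem_iUnion, Set.mem_iInter] at hx
      obtain ⟨S, hS, hSx⟩ := hx
      have hsub : S ⊆ {i : W | (⟨x, hxy⟩ : π ⁻¹' {y}) ∈ i.1} := by
        intro i hi
        have hxO := (hf' i x).1 (hη0.trans_le (hSx i hi))
        have : (⟨x, hxy⟩ : π ⁻¹' {y}) ∈ (Subtype.val ⁻¹' (O i) : Set (π ⁻¹' {y})) := hxO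
        rwa [hOi i] at this
      have h1 := (Set.ncard_le_ncard hsub (Set.toFinite _)).trans (hm _)
      have h2 : k + 2 ≤ S.ncard := hS
      have h3 : coverDim (MeanDim.restrict U (π ⁻¹' {y})) ≤ k := hy
      omega
  have hπB : IsClosed (π '' B) := (hB.isCompact.image hπ).isClosed
  refine mem_of_superset (hπB.isOpen_compl.mem_nhds hyB) fun y' hy' => ?_
  refine coverDim_le_of_indexed (fun i : W => (Subtype.val ⁻¹' {x | η < f i x} : Set (π ⁻¹' {y'})))
    (fun i => (isOpen_lt continuous_const (hf i)).preimage continuous_subtype_val) ?_ ?_ ?_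
  · rintro ⟨x, hx⟩
    by_contra hcon
    refine hy' ⟨x, Or.inl fun hx' => hcon ?_, hx⟩
    obtain ⟨i, hi⟩ := Set.mem_iUnion.1 hx'
    exact ⟨i, hi⟩
  · intro i
    refine ⟨_, ⟨A i, hA i, rfl⟩, fun x hx => hOA i ((hf' i x).1 (hη0.trans hx))⟩
  · rintro ⟨x, hx⟩
    by_contra hcon
    push Not at hcon
    refine hy' ⟨x, Or.inr ?_, hx⟩
    simp only [Set.mem_iUnion, Set.mem_iInter]
    exact ⟨_, hcon, fun i hi => le_of_lt (show η < f i x from hi)⟩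

end Covers

/-! ### The dimension of the iterated covers on the fibres -/

section FiberDim

variable {Γ X Y : Type*} [Group Γ] [TopologicalSpace X] [MulAction Γ X]

theorem IsFinOpenCover.coverPow [ContinuousConstSMul Γ X] {U : Set (Set X)}
    (hU : IsFinOpenCover U) (F : Finset Γ) : IsFinOpenCover (coverPow U F) := by
  refine ⟨?_, ?_, ?_⟩
  · have := hU.finite.to_subtype
    refine (Set.finite_range fun v : F → U => ⋂ s : F, (fun x : X => s.1 • x) ⁻¹' (v s).1).subset ?_
    rintro _ ⟨u, hu, rfl⟩
    refine ⟨fun s => ⟨u s.1, hu s.1 s.2⟩, ?_⟩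
    ext x
    simp
  · rintro _ ⟨u, hu, rfl⟩
    exact isOpen_biInter_finset fun s hs => (hU.isOpen _ (hu s hs)).preimage (continuous_const_smul s)
  · refine Set.eq_univ_of_forall fun x => ?_
    have h : ∀ s : Γ, ∃ A ∈ U, s • x ∈ A := fun s => by
      have hx : s • x ∈ ⋃₀ U := hU.covers ▸ Set.mem_univ _
      exact hx
    choose u hu hxu using h
    exact ⟨_, ⟨u, fun s _ => hu s, rfl⟩, by simpa using fun s _ => hxu s⟩

/-- The dimension of the cover `U^F` restricted to the fibre over `y`. -/
noncomputable def fiberDim (π : X → Y) (U : Set (Set X)) (y : Y) (F : Finset Γ) : ℕ :=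
  coverDim (restrict (coverPow U F) (π ⁻¹' {y}))

theorem fiberDim_empty (π : X → Y) (U : Set (Set X)) (y : Y) :
    fiberDim π U y (∅ : Finset Γ) = 0 := by
  refine Nat.le_zero.1 (coverDim_le_of_indexed (fun _ : Unit => Set.univ) (fun _ => isOpen_univ)
    (fun _ => ⟨(), trivial⟩) (fun _ => ⟨Set.univ, ⟨Set.univ, ⟨fun _ => ∅, ?_⟩, ?_⟩, subset_rfl⟩)
    fun x => ?_)
  · simp
  · simp
  · simp

variable [ContinuousConstSMul Γ X]

theorem fiberDim_le_add [TopologicalSpace.MetrizableSpace X] (π : X → Y) {U : Set (Set X)}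
    (hU : IsFinOpenCover U) (y : Y) {E F F' : Finset Γ} (h : ∀ s ∈ E, s ∈ F ∨ s ∈ F') :
    fiberDim π U y E ≤ fiberDim π U y F + fiberDim π U y F' := by
  classical
  refine coverDim_le_add ((hU.coverPow F).restrict _) ((hU.coverPow F').restrict _) ?_
  rintro _ ⟨_, ⟨u, hu, rfl⟩, rfl⟩ _ ⟨_, ⟨v, hv, rfl⟩, rfl⟩
  refine ⟨_, ⟨_, ⟨fun s => if s ∈ F then u s else v s, fun s hs => ?_, rfl⟩, rfl⟩, ?_⟩
  · by_cases hsF : s ∈ F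
    · simpa [hsF] using hu s hsF
    · simpa [hsF] using hv s ((h s hs).resolve_left hsF)
  · rintro x ⟨hx, hx'⟩
    simp only [Set.mem_preimage, Set.mem_iInter] at hx hx' ⊢
    intro s hs
    by_cases hsF : s ∈ F
    · simpa [hsF] using hx s hsF
    · simpa [hsF] using hx' s ((h s hs).resolve_left hsF)

theorem fiberDim_le_sum [TopologicalSpace.MetrizableSpace X] (π : X → Y) {U : Set (Set X)}
    (hU : IsFinOpenCover U) (y : Y) {ι : Type*} (I : Finset ι) (G : ι → Finset Γ) (E : Finset Γ)
    (h : ∀ s ∈ E, ∃ i ∈ I, s ∈ G i) : fiberDim π U y E ≤ ∑ i ∈ I, fiberDim π U y (G i) := by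
  classical
  induction I using Finset.induction_on generalizing E with
  | empty =>
    have : E = ∅ := Finset.eq_empty_of_forall_notMem fun s hs => by simpa using h s hs
    simp [this, fiberDim_empty]
  | insert i I hi ih =>
    rw [Finset.sum_insert hi]
    refine (fiberDim_le_add π hU y (F := G i) (F' := E \ G i) fun s hs => ?_).trans
      (Nat.add_le_add_left (ih _ fun s hs => ?_) _)
    · by_cases hsi : s ∈ G i
      · exact Or.inl hsi
      · exact Or.inr (Finset.mem_sdiff.2 ⟨hs, hsi⟩)
    · obtain ⟨hs, hsi⟩ := Finset.mem_sdiff.1 hs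
      obtain ⟨j, hj, hsj⟩ := h s hs
      rcases Finset.mem_insert.1 hj with rfl | hj
      · exact absurd hsj hsi
      · exact ⟨j, hj, hsj⟩

theorem fiberDim_singleton_le (π : X → Y) {U : Set (Set X)} (hU : IsFinOpenCover U) (y : Y)
    (s : Γ) : fiberDim π U y {s} ≤ U.ncard := by
  have := hU.finite.to_subtype
  refine coverDim_le_of_indexed (fun A : U => (fun x : π ⁻¹' {y} => s • x.1) ⁻¹' A.1)
    (fun A => (hU.isOpen _ A.2).preimage (by fun_prop)) (fun x => ?_) (fun A => ?_) (fun x => ?_)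
  · have hx : s • x.1 ∈ ⋃₀ U := hU.covers ▸ Set.mem_univ _
    obtain ⟨A, hA, hxA⟩ := hx
    exact ⟨⟨A, hA⟩, hxA⟩
  · refine ⟨_, ⟨_, ⟨fun _ => A.1, fun _ _ => A.2, rfl⟩, rfl⟩, fun x hx => ?_⟩
    simpa using hx
  · calc _ ≤ (Set.univ : Set U).ncard := Set.ncard_le_ncard (Set.subset_univ _) (Set.toFinite _)
      _ = U.ncard := Set.ncard_univ _
      _ ≤ _ := Nat.le_succ _

/-- The uniformity in `y` is what matters: this bound makes the integrals finite, supplies the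
majorant for the reverse Fatou lemma and prices the boundary points of a tiling. -/
theorem fiberDim_le_card_mul [TopologicalSpace.MetrizableSpace X] (π : X → Y) {U : Set (Set X)}
    (hU : IsFinOpenCover U) (y : Y) (F : Finset Γ) : fiberDim π U y F ≤ F.card * U.ncard := by
  refine (fiberDim_le_sum π hU y F (fun s => {s}) F fun s hs => ⟨s, hs, by simp⟩).trans ?_
  rw [← smul_eq_mul]
  exact Finset.sum_le_card_nsmul _ _ _ fun s _ => fiberDim_singleton_le π hU y s

/-- Acting by `s` maps the fibre over `y` into the fibre over `s • y`, and `t • (s • x) = (t * s) •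
x` pulls `U^F` back to `U^(F s)`. -/
theorem fiberDim_translate_le [MulAction Γ Y] {π : X → Y} (hπ : ∀ (s : Γ) (x : X), π (s • x) = s • π x)
    {U : Set (Set X)} (hU : IsFinOpenCover U) (y : Y) (F : Finset Γ) (s : Γ) :
    fiberDim π U y (F.map (mulRightEmbedding s)) ≤ fiberDim π U (s • y) F := by
  refine coverDim_le_of_continuous ((hU.coverPow F).restrict _)
    (f := fun x : π ⁻¹' {y} => (⟨s • x.1, by
      have := x.2
      simp only [Set.mem_preimage, Set.mem_singleton_iff] at this ⊢
      rw [hπ, this]⟩ : π ⁻¹' {s • y})) (by fun_prop) ?_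
  rintro _ ⟨_, ⟨u, hu, rfl⟩, rfl⟩
  refine ⟨_, ⟨_, ⟨fun t => u (t * s⁻¹), fun t ht => ?_, rfl⟩, rfl⟩, fun x hx => ?_⟩
  · obtain ⟨r, hr, rfl⟩ := Finset.mem_map.1 ht
    simpa using hu r hr
  · simpa [mul_smul] using hx

theorem fiberDim_translate [MulAction Γ Y] {π : X → Y} (hπ : ∀ (s : Γ) (x : X), π (s • x) = s • π x)
    {U : Set (Set X)} (hU : IsFinOpenCover U) (y : Y) (F : Finset Γ) (s : Γ) :
    fiberDim π U y (F.map (mulRightEmbedding s)) = fiberDim π U (s • y) F := by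
  refine le_antisymm (fiberDim_translate_le hπ hU y F s) ?_
  have h := fiberDim_translate_le hπ hU (s • y) (F.map (mulRightEmbedding s)) s⁻¹
  have hF : (F.map (mulRightEmbedding s)).map (mulRightEmbedding s⁻¹) = F := by
    ext t
    simp
  rwa [hF, inv_smul_smul] at h

theorem isOpen_fiberDim_le [CompactSpace X] [TopologicalSpace.MetrizableSpace X]
    [TopologicalSpace Y] [T2Space Y] {π : X → Y} (hπ : Continuous π) {U : Set (Set X)}
    (hU : IsFinOpenCover U) (F : Finset Γ) (k : ℕ) : IsOpen {y | fiberDim π U y F ≤ k} :=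
  isOpen_coverDim_fiber_le hπ (hU.coverPow F) k

theorem measurable_fiberDim [CompactSpace X] [TopologicalSpace.MetrizableSpace X]
    [TopologicalSpace Y] [T2Space Y] [MeasurableSpace Y] [BorelSpace Y] {π : X → Y}
    (hπ : Continuous π) {U : Set (Set X)} (hU : IsFinOpenCover U) (F : Finset Γ) :
    Measurable fun y => fiberDim π U y F :=
  measurable_of_Iic fun k => (isOpen_fiberDim_le hπ hU F k).measurableSet

end FiberDim

/-! ### Convergence of subadditive functions of almost invariant sets -/

section OrnsteinWeiss

open scoped Pointwise

variable {Γ : Type*} [Group Γ]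

theorem almostInvariant_mem_invFilter {K : Finset Γ} (hK : K.Nonempty) {δ : ℝ} (hδ : 0 < δ) :
    almostInvariant K δ ∈ invFilter Γ :=
  mem_iInf_of_mem K <| mem_iInf_of_mem hK <| mem_iInf_of_mem δ <| mem_iInf_of_mem hδ <|
    mem_principal_self _

/-- Invariance is restated as smallness of the boundary, the quantity that can be added up when sets
are cut apart. -/
theorem mem_almostInvariant_iff [DecidableEq Γ] {K F : Finset Γ} {δ : ℝ} :
    F ∈ almostInvariant K δ ↔
      F.Nonempty ∧ ((F.filter fun t => ∃ k ∈ K, k * t ∉ F).card : ℝ) ≤ δ * F.card := by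
  have h1 : {t ∈ (F : Set Γ) | ∀ k ∈ K, k * t ∈ F}.ncard
      = (F.filter fun t => ∀ k ∈ K, k * t ∈ F).card := by
    rw [← Set.ncard_coe_finset]
    simp
  have h2 := Finset.card_filter_add_card_filter_not (s := F) (fun t => ∀ k ∈ K, k * t ∈ F)
  have h3 : (F.filter fun t => ¬ ∀ k ∈ K, k * t ∈ F) = F.filter fun t => ∃ k ∈ K, k * t ∉ F := by
    ext t
    simp
  rw [h3] at h2
  have h4 : ((F.filter fun t => ∀ k ∈ K, k * t ∈ F).card : ℝ)
      + (F.filter fun t => ∃ k ∈ K, k * t ∉ F).card = F.card := by exact_mod_cast h2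
  unfold almostInvariant
  rw [Set.mem_ofPred_eq, h1]
  refine and_congr_right fun _ => ⟨fun h => by linarith, fun h => by linarith⟩

/-- A maximal family of almost disjoint right translates of `F` inside `A` covers a definite
proportion of the points `t` with `F t ⊆ A`. -/
theorem exists_almost_disjoint_translates [DecidableEq Γ] {F : Finset Γ} (hF : F.Nonempty)
    (A : Finset Γ) {ε : ℝ} (hε₁ : ε < 1) :
    ∃ C : Finset Γ, F * C ⊆ A ∧ (1 - ε) * (F.card * C.card) ≤ ((F * C).card : ℝ) ∧
      ε * ((A.filter fun t => ∀ f ∈ F, f * t ∈ A).card : ℝ) ≤ (F * C).card := by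
  set I := A.filter fun t => ∀ f ∈ F, f * t ∈ A with hI
  have hFpos : (0 : ℝ) < F.card := by exact_mod_cast hF.card_pos
  obtain ⟨C, hC, hmax⟩ := Finset.exists_max_image
    (I.powerset.filter fun C => (1 - ε) * (F.card * C.card) ≤ ((F * C).card : ℝ)) Finset.card
    ⟨∅, by simp⟩
  simp only [Finset.mem_filter, Finset.mem_powerset] at hC hmax
  refine ⟨C, ?_, hC.2, ?_⟩
  · intro x hx
    obtain ⟨f, hf, c, hc, rfl⟩ := Finset.mem_mul.1 hx
    exact (Finset.mem_filter.1 (hC.1 hc)).2 f hf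
  -- By maximality of `C`: a translate `F t` meeting `F * C` in fewer than `ε |F|` points could be
  -- added to the family. The hypothesis `ε < 1` rules out `t ∈ C`.
  have hbig : ∀ t ∈ I, ε * F.card ≤ (((F * {t}) ∩ (F * C)).card : ℝ) := by
    intro t ht
    by_contra hlt
    push Not at hlt
    have htC : t ∉ C := by
      intro htC
      have : (F * {t}) ∩ (F * C) = F * {t} := Finset.inter_eq_left.2
        (Finset.mul_subset_mul_left (by simpa using htC))
      rw [this, Finset.card_mul_singleton] at hlt
      nlinarith
    have hcard : ((F * insert t C).card : ℝ) + ((F * {t}) ∩ (F * C)).card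
        = F.card + (F * C).card := by
      rw [Finset.insert_eq, Finset.mul_union]
      have := Finset.card_union_add_card_inter (F * {t}) (F * C)
      rw [Finset.card_mul_singleton] at this
      exact_mod_cast this
    have := hmax (insert t C) ⟨Finset.insert_subset ht hC.1, by
      rw [Finset.card_insert_of_notMem htC]
      push_cast
      nlinarith [hC.2]⟩
    rw [Finset.card_insert_of_notMem htC] at this
    omega
  -- Double counting: a point `b` lies in `F t` only if `b * t⁻¹ ∈ F`, hence in at most `|F|`
  -- translates.
  have hcount : ∑ t ∈ I, ((F * {t}) ∩ (F * C)).card ≤ (F * C).card * F.card := by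
    calc ∑ t ∈ I, ((F * {t}) ∩ (F * C)).card
        = ∑ t ∈ I, ((F * C).filter fun b => b ∈ F * {t}).card := by
          refine Finset.sum_congr rfl fun t _ => ?_
          rw [Finset.inter_comm, ← Finset.filter_mem_eq_inter]
      _ = ∑ b ∈ F * C, (I.filter fun t => b ∈ F * {t}).card := by
          simp only [Finset.card_filter]
          exact Finset.sum_comm
      _ ≤ ∑ b ∈ F * C, F.card := by
          refine Finset.sum_le_sum fun b _ => ?_
          refine Finset.card_le_card_of_injOn (fun t => b * t⁻¹) (fun t ht => ?_)
            (fun t _ t' _ h => by simpa using h)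
          obtain ⟨f, hf, t', ht', h⟩ := Finset.mem_mul.1 (Finset.mem_filter.1 ht).2
          rw [Finset.mem_singleton] at ht'
          subst ht' h
          simpa using hf
      _ = _ := by rw [Finset.sum_const, smul_eq_mul]
  have h1 : (I.card : ℝ) * (ε * F.card) ≤ ∑ t ∈ I, (((F * {t}) ∩ (F * C)).card : ℝ) := by
    rw [← nsmul_eq_mul]
    exact Finset.card_nsmul_le_sum _ _ _ hbig
  have h2 : ∑ t ∈ I, (((F * {t}) ∩ (F * C)).card : ℝ) ≤ (F * C).card * F.card := by
    exact_mod_cast hcount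
  have h3 : (ε * I.card) * F.card ≤ ((F * C).card : ℝ) * F.card := by linarith
  exact le_of_mul_le_mul_right h3 hFpos

/-- Removing translates of an almost invariant set `F` from `A` creates few new boundary
points. -/
theorem card_boundary_sdiff_le [DecidableEq Γ] {F K A C : Finset Γ} {η : ℝ}
    (hF : F ∈ almostInvariant K η) :
    ((((A \ (F * C)).filter fun t => ∃ k ∈ K, k * t ∉ A \ (F * C)).card : ℕ) : ℝ) ≤
      (A.filter fun t => ∃ k ∈ K, k * t ∉ A).card + K.card * (η * F.card) * C.card := by
  have hk : ∀ k ∈ K, ((F.image fun s => k⁻¹ * s) \ F).card ≤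
      (F.filter fun t => ∃ k ∈ K, k * t ∉ F).card := by
    intro k hkK
    have h1 : ((F.image fun s => k⁻¹ * s) \ F).card = (F \ (F.image fun s => k⁻¹ * s)).card :=
      Finset.card_sdiff_comm (Finset.card_image_of_injective _ (mul_right_injective k⁻¹))
    rw [h1]
    refine Finset.card_le_card fun t ht => ?_
    obtain ⟨htF, ht⟩ := Finset.mem_sdiff.1 ht
    refine Finset.mem_filter.2 ⟨htF, k, hkK, fun hkt => ht ?_⟩
    exact Finset.mem_image.2 ⟨k * t, hkt, by simp⟩
  -- A new boundary point `t` has `k * t = f * c` in a removed translate, so `t ∈ (k⁻¹F \ F) c`; by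
  -- `hk` the number of such points is controlled by the boundary of `F`.
  have hsub : ((A \ (F * C)).filter fun t => ∃ k ∈ K, k * t ∉ A \ (F * C)) ⊆
      (A.filter fun t => ∃ k ∈ K, k * t ∉ A) ∪
        K.biUnion fun k => C.biUnion fun c =>
          ((F.image fun s => k⁻¹ * s) \ F).image fun s => s * c := by
    intro t ht
    obtain ⟨ht, k, hkK, hkt⟩ := Finset.mem_filter.1 ht
    obtain ⟨htA, htB⟩ := Finset.mem_sdiff.1 ht
    by_cases hA : k * t ∈ A
    · have hB : k * t ∈ F * C := by
        by_contra hB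
        exact hkt (Finset.mem_sdiff.2 ⟨hA, hB⟩)
      obtain ⟨f, hf, c, hc, hfc⟩ := Finset.mem_mul.1 hB
      have htc : t = k⁻¹ * f * c := by rw [mul_assoc, hfc]; simp
      refine Finset.mem_union_right _ (Finset.mem_biUnion.2 ⟨k, hkK, Finset.mem_biUnion.2
        ⟨c, hc, Finset.mem_image.2 ⟨k⁻¹ * f, Finset.mem_sdiff.2 ⟨?_, ?_⟩, htc.symm⟩⟩⟩)
      · exact Finset.mem_image_of_mem _ hf
      · intro hmem
        exact htB (htc ▸ Finset.mul_mem_mul hmem hc)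
    · exact Finset.mem_union_left _ (Finset.mem_filter.2 ⟨htA, k, hkK, hA⟩)
  have hcard : ((A \ (F * C)).filter fun t => ∃ k ∈ K, k * t ∉ A \ (F * C)).card ≤
      (A.filter fun t => ∃ k ∈ K, k * t ∉ A).card +
        K.card * (C.card * (F.filter fun t => ∃ k ∈ K, k * t ∉ F).card) := by
    refine (Finset.card_le_card hsub).trans ((Finset.card_union_le _ _).trans
      (Nat.add_le_add_left ?_ _))
    refine Finset.card_biUnion_le_card_mul _ _ _ fun k hkK => ?_
    refine Finset.card_biUnion_le_card_mul _ _ _ fun c _ => ?_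
    exact Finset.card_image_le.trans (hk k hkK)
  have h2 := (mem_almostInvariant_iff.1 hF).2
  calc ((((A \ (F * C)).filter fun t => ∃ k ∈ K, k * t ∉ A \ (F * C)).card : ℕ) : ℝ)
      ≤ (A.filter fun t => ∃ k ∈ K, k * t ∉ A).card +
        K.card * (C.card * (F.filter fun t => ∃ k ∈ K, k * t ∉ F).card) := by
        exact_mod_cast hcard
    _ ≤ (A.filter fun t => ∃ k ∈ K, k * t ∉ A).card + K.card * (C.card * (η * F.card)) := by
        gcongr
    _ = _ := by ring

/-- Real-valued functions of finite subsets which are monotone, subadditive, invariant under right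
translations, and bounded by a multiple of the cardinality. -/
structure IsSubadditiveInvariant (φ : Finset Γ → ℝ) (M : ℝ) : Prop where
  nonneg : ∀ F, 0 ≤ φ F
  -- Monotonicity is the case `F' = ∅`, where `φ` vanishes by `nonneg` and `le_mul_card`.
  le_add : ∀ E F F' : Finset Γ, (∀ s ∈ E, s ∈ F ∨ s ∈ F') → φ E ≤ φ F + φ F'
  translate : ∀ (F : Finset Γ) (s : Γ), φ (F.map (mulRightEmbedding s)) = φ F
  le_mul_card : ∀ F, φ F ≤ M * F.card

namespace IsSubadditiveInvariant

variable {φ : Finset Γ → ℝ} {M : ℝ}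

theorem bound_nonneg (hφ : IsSubadditiveInvariant φ M) : 0 ≤ M := by
  have := (hφ.nonneg {1}).trans (hφ.le_mul_card {1})
  simpa using this

theorem le_card_mul [DecidableEq Γ] (hφ : IsSubadditiveInvariant φ M) (F C : Finset Γ) :
    φ (F * C) ≤ C.card * φ F := by
  induction C using Finset.induction_on with
  | empty => simpa using hφ.le_mul_card ∅
  | insert c C hc ih =>
    rw [Finset.card_insert_of_notMem hc]
    have h := hφ.le_add (F * insert c C) (F.map (mulRightEmbedding c)) (F * C) (by
      intro s hs
      obtain ⟨f, hf, c', hc', rfl⟩ := Finset.mem_mul.1 hs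
      rcases Finset.mem_insert.1 hc' with rfl | hc'
      · exact Or.inl (Finset.mem_map.2 ⟨f, hf, rfl⟩)
      · exact Or.inr (Finset.mul_mem_mul hf hc'))
    rw [hφ.translate] at h
    push_cast
    linarith

/-- The quasi-tiling estimate. -/
theorem exists_le_of_frequently (hφ : IsSubadditiveInvariant φ M) {b : ℝ}
    (hb : ∃ᶠ F in invFilter Γ, φ F / F.card < b) {ε : ℝ} (hε : 0 < ε) (hε₁ : ε < 1) (k : ℕ) :
    ∃ K : Finset Γ, K.Nonempty ∧ ∃ δ : ℝ, 0 < δ ∧ ∀ A ∈ almostInvariant K δ,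
      φ A ≤ b / (1 - ε) * A.card + M * ((ε + (1 - ε / 2) ^ k) * A.card) := by
  classical
  have hM := hφ.bound_nonneg
  have hb0 : 0 < b := by
    obtain ⟨F, hF⟩ := hb.exists
    exact (div_nonneg (hφ.nonneg F) (Nat.cast_nonneg _)).trans_lt hF
  have hε' : 0 < 1 - ε := by linarith
  have hb' : 0 ≤ b / (1 - ε) := by positivity
  induction k with
  | zero =>
    -- For `k = 0` the power equals `1` and the trivial bound `M |A|` suffices, so the choice of `K`
    -- and `δ` is immaterial.
    refine ⟨{1}, Finset.singleton_nonempty _, 1, one_pos, fun A _ => ?_⟩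
    have h1 := hφ.le_mul_card A
    have h2 : 0 ≤ b / (1 - ε) * A.card := by positivity
    have h3 : 0 ≤ M * (ε * A.card) := by positivity
    rw [pow_zero]
    linarith
  | succ k ih =>
    obtain ⟨K, hK, δ, hδ, ih⟩ := ih
    have hKpos : (0 : ℝ) < K.card := by exact_mod_cast hK.card_pos
    -- Chosen so that the removed translates, of total size at most `|B| / (1 - ε)`, add at most `ε
    -- δ / 2 * |A|` boundary points. The old boundary of `A` contributes as much again, and together
    -- they stay below `δ |R|` as soon as `|R| > ε |A|`.
    set η : ℝ := ε * (1 - ε) * δ / (2 * K.card) with hη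
    have hηpos : 0 < η := by positivity
    obtain ⟨F, hFb, hF⟩ := (hb.and_eventually (almostInvariant_mem_invFilter hK hηpos)).exists
    have hFne : F.Nonempty := hF.1
    have hFpos : (0 : ℝ) < F.card := by exact_mod_cast hFne.card_pos
    rw [div_lt_iff₀ hFpos] at hFb
    refine ⟨F ∪ K, hFne.mono Finset.subset_union_left, min (1 / 2) (ε * δ / 2),
      lt_min (by norm_num) (by positivity), fun A hA => ?_⟩
    obtain ⟨hAne, hA⟩ := mem_almostInvariant_iff.1 hA
    have hApos : (0 : ℝ) < A.card := by exact_mod_cast hAne.card_pos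
    obtain ⟨C, hCA, hCdisj, hCbig⟩ := exists_almost_disjoint_translates hFne A hε₁
    set B := F * C with hB
    set R := A \ B with hR
    have hBR : (B.card : ℝ) + R.card = A.card := by
      have := Finset.card_sdiff_add_card_eq_card hCA
      rw [add_comm]
      exact_mod_cast this
    have hφA : φ A ≤ φ B + φ R := hφ.le_add A B R fun s hs => by
      by_cases h : s ∈ B
      · exact Or.inl h
      · exact Or.inr (Finset.mem_sdiff.2 ⟨hs, h⟩)
    have hFC : (F.card : ℝ) * C.card ≤ B.card / (1 - ε) := by
      rw [le_div_iff₀ hε']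
      linarith
    have hφB : φ B ≤ b / (1 - ε) * B.card := by
      calc φ B ≤ C.card * φ F := hφ.le_card_mul F C
        _ ≤ C.card * (b * F.card) := by gcongr
        _ = b * (F.card * C.card) := by ring
        _ ≤ b * (B.card / (1 - ε)) := by gcongr
        _ = _ := by ring
    have hpow : 0 ≤ (1 - ε / 2) ^ (k + 1) := pow_nonneg (by linarith) _
    by_cases hsmall : (R.card : ℝ) ≤ ε * A.card
    · have h1 : φ R ≤ M * (ε * A.card) := (hφ.le_mul_card R).trans (by gcongr)
      have h2 : b / (1 - ε) * B.card ≤ b / (1 - ε) * A.card := by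
        gcongr
      have h3 : 0 ≤ M * ((1 - ε / 2) ^ (k + 1) * A.card) := by positivity
      linarith
    · push Not at hsmall
      have hRpos : (0 : ℝ) < R.card := lt_trans (by positivity) hsmall
      have hbdK : ((A.filter fun t => ∃ k ∈ K, k * t ∉ A).card : ℝ) ≤ ε * δ / 2 * A.card := by
        refine le_trans ?_ (hA.trans (mul_le_mul_of_nonneg_right (min_le_right _ _) hApos.le))
        norm_cast
        refine Finset.card_le_card (Finset.monotone_filter_right _ fun t _ => ?_)
        rintro ⟨k, hk, hkt⟩
        exact ⟨k, Finset.mem_union_right _ hk, hkt⟩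
      have hRinv : R ∈ almostInvariant K δ := by
        rw [mem_almostInvariant_iff]
        refine ⟨Finset.card_pos.1 (by exact_mod_cast hRpos), ?_⟩
        refine (card_boundary_sdiff_le hF).trans ?_
        have h1 : (K.card : ℝ) * (η * F.card) * C.card ≤ ε * δ / 2 * A.card := by
          calc (K.card : ℝ) * (η * F.card) * C.card = K.card * η * (F.card * C.card) := by ring
            _ ≤ K.card * η * (B.card / (1 - ε)) := by gcongr
            _ = ε * δ / 2 * B.card := by
              rw [hη]
              field_simp
            _ ≤ ε * δ / 2 * A.card := by
              gcongr
        have h2 : δ * (ε * A.card) ≤ δ * R.card := by gcongr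
        linarith
      -- At least half of the points of `A` are admissible centres, so the translates fill at least
      -- the proportion `ε / 2` of `A`.
      have hRle : (R.card : ℝ) ≤ (1 - ε / 2) * A.card := by
        have hgood : ((A.filter fun t => ∃ f ∈ F, f * t ∉ A).card : ℝ) ≤ 1 / 2 * A.card := by
          refine le_trans ?_ (hA.trans (mul_le_mul_of_nonneg_right (min_le_left _ _) hApos.le))
          norm_cast
          refine Finset.card_le_card (Finset.monotone_filter_right _ fun t _ => ?_)
          rintro ⟨k, hk, hkt⟩
          exact ⟨k, Finset.mem_union_left _ hk, hkt⟩
        have hsplit : ((A.filter fun t => ∀ f ∈ F, f * t ∈ A).card : ℝ)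
            + (A.filter fun t => ∃ f ∈ F, f * t ∉ A).card = A.card := by
          have h := Finset.card_filter_add_card_filter_not (s := A) (fun t => ∀ f ∈ F, f * t ∈ A)
          have h3 : (A.filter fun t => ¬ ∀ f ∈ F, f * t ∈ A)
              = A.filter fun t => ∃ f ∈ F, f * t ∉ A := by
            ext t
            simp
          rw [h3] at h
          exact_mod_cast h
        nlinarith
      have hφR := ih R hRinv
      have hpk : 0 ≤ (1 - ε / 2) ^ k := pow_nonneg (by linarith) _
      have h4 : (ε + (1 - ε / 2) ^ k) * R.card ≤ (ε + (1 - ε / 2) ^ (k + 1)) * A.card := by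
        calc (ε + (1 - ε / 2) ^ k) * R.card
            ≤ (ε + (1 - ε / 2) ^ k) * ((1 - ε / 2) * A.card) := by gcongr
          _ = (ε * (1 - ε / 2) + (1 - ε / 2) ^ (k + 1)) * A.card := by ring
          _ ≤ _ := by
            gcongr
            nlinarith
      have h5 : M * ((ε + (1 - ε / 2) ^ k) * R.card) ≤
          M * ((ε + (1 - ε / 2) ^ (k + 1)) * A.card) := by gcongr
      calc φ A ≤ φ B + φ R := hφA
        _ ≤ b / (1 - ε) * (B.card + R.card) + M * ((ε + (1 - ε / 2) ^ k) * R.card) := by linarith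
        _ ≤ _ := by
          rw [hBR]
          linarith

/-- The Ornstein–Weiss lemma. -/
theorem exists_tendsto (hφ : IsSubadditiveInvariant φ M) :
    ∃ c : ℝ, Tendsto (fun F : Finset Γ => φ F / F.card) (invFilter Γ) (𝓝 c) := by
  have hM := hφ.bound_nonneg
  have hle : ∀ F : Finset Γ, φ F / F.card ≤ M := fun F =>
    div_le_of_le_mul₀ (Nat.cast_nonneg _) hM (hφ.le_mul_card F)
  refine tendsto_of_no_upcrossings dense_univ ?_ (isBoundedUnder_of ⟨M, hle⟩)
    (isBoundedUnder_of ⟨0, fun F => div_nonneg (hφ.nonneg F) (Nat.cast_nonneg _)⟩)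
  rintro a - b - hab ⟨ha, hb⟩
  have hlim : Tendsto (fun ε : ℝ => a / (1 - ε) + M * (ε + ε)) (𝓝[>] 0) (𝓝 a) := by
    have h : ContinuousAt (fun ε : ℝ => a / (1 - ε) + M * (ε + ε)) 0 := by
      refine ContinuousAt.add (ContinuousAt.div continuousAt_const (by fun_prop) (by norm_num))
        (by fun_prop)
    have h' : Tendsto (fun ε : ℝ => a / (1 - ε) + M * (ε + ε)) (𝓝 0) (𝓝 a) := by
      simpa [ContinuousAt] using h
    exact h'.mono_left nhdsWithin_le_nhds
  -- With `ε` this small and `(1 - ε / 2) ^ k < ε`, the quasi-tiling estimate keeps the averages at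
  -- most `b` eventually, which excludes an upcrossing of `[a, b]`.
  obtain ⟨ε, hεb, hε, hε₁⟩ := ((hlim.eventually_lt_const hab).and
    (Ioo_mem_nhdsGT (one_pos (α := ℝ)))).exists
  obtain ⟨k, hk⟩ := exists_pow_lt_of_lt_one hε (show 1 - ε / 2 < 1 by linarith)
  obtain ⟨K, hK, δ, hδ, h⟩ := hφ.exists_le_of_frequently ha hε hε₁ k
  refine hb ?_
  filter_upwards [almostInvariant_mem_invFilter hK hδ] with A hA
  have hApos : (0 : ℝ) < A.card := by exact_mod_cast hA.1.card_pos
  rw [not_lt, div_le_iff₀ hApos]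
  calc φ A ≤ _ := h A hA
    _ ≤ a / (1 - ε) * A.card + M * ((ε + ε) * A.card) := by gcongr
    _ = (a / (1 - ε) + M * (ε + ε)) * A.card := by ring
    _ ≤ b * A.card := by gcongr

end IsSubadditiveInvariant

/-- The members of a Følner sequence become more and more invariant. -/
theorem IsFolnerSeq.tendsto_invFilter {F : ℕ → Finset Γ} (hF : IsFolnerSeq F) :
    Tendsto F atTop (invFilter Γ) := by
  classical
  refine tendsto_iInf.2 fun K => tendsto_iInf.2 fun hK => tendsto_iInf.2 fun δ =>
    tendsto_iInf.2 fun hδ => tendsto_principal.2 ?_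
  have hsum : Tendsto (fun n => ∑ s ∈ K,
      ((symmDiff ((fun t => s * t) '' (F n : Set Γ)) (F n : Set Γ)).ncard : ℝ) / ((F n).card : ℝ))
      atTop (𝓝 0) := by
    simpa using tendsto_finsetSum K fun s _ => hF.tendsto s
  filter_upwards [hsum.eventually_lt_const hδ] with n hn
  have hpos : (0 : ℝ) < (F n).card := by exact_mod_cast (hF.nonempty n).card_pos
  rw [← Finset.sum_div, div_lt_iff₀ hpos] at hn
  refine mem_almostInvariant_iff.2 ⟨hF.nonempty n, le_trans ?_ hn.le⟩
  have hsub : ((F n).filter fun t => ∃ k ∈ K, k * t ∉ F n) ⊆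
      K.biUnion fun k => (F n).filter fun t => k * t ∉ F n := by
    intro t ht
    obtain ⟨htF, k, hk, hkt⟩ := Finset.mem_filter.1 ht
    exact Finset.mem_biUnion.2 ⟨k, hk, Finset.mem_filter.2 ⟨htF, hkt⟩⟩
  have hcard : ((F n).filter fun t => ∃ k ∈ K, k * t ∉ F n).card ≤
      ∑ s ∈ K, (symmDiff ((fun t => s * t) '' (F n : Set Γ)) (F n : Set Γ)).ncard := by
    refine (Finset.card_le_card hsub).trans (Finset.card_biUnion_le.trans
      (Finset.sum_le_sum fun k _ => ?_))
    rw [← Set.ncard_coe_finset]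
    refine Set.ncard_le_ncard_of_injOn (fun t => k * t) (fun t ht => ?_)
      (fun t _ t' _ h => mul_left_cancel h) ?_
    · obtain ⟨htF, hkt⟩ := Finset.mem_filter.1 (Finset.mem_coe.1 ht)
      exact Or.inl ⟨⟨t, htF, rfl⟩, hkt⟩
    · exact (((F n).finite_toSet.image _).union (F n).finite_toSet).subset
        Set.symmDiff_subset_union
  exact_mod_cast hcard

end OrnsteinWeiss

/-! ### Existence of the limits -/

section Limit

variable {Γ X Y : Type*} [Group Γ] [TopologicalSpace X] [MulAction Γ X] [MeasurableSpace Y]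
  {π : X → Y}

theorem coverDimGiven_coverPow (ν : Measure Y) (U : Set (Set X)) (F : Finset Γ) :
    coverDimGiven π ν (coverPow U F) = ∫⁻ y, (fiberDim π U y F : ℝ≥0∞) ∂ν :=
  rfl

variable [TopologicalSpace.MetrizableSpace X] [ContinuousConstSMul Γ X]

theorem coverDimGiven_coverPow_le (ν : Measure Y) [IsProbabilityMeasure ν] {U : Set (Set X)}
    (hU : IsFinOpenCover U) (F : Finset Γ) :
    coverDimGiven π ν (coverPow U F) ≤ (F.card * U.ncard : ℕ) := by
  rw [coverDimGiven_coverPow]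
  calc ∫⁻ y, (fiberDim π U y F : ℝ≥0∞) ∂ν ≤ ∫⁻ _, ((F.card * U.ncard : ℕ) : ℝ≥0∞) ∂ν :=
        lintegral_mono fun y => Nat.mono_cast (fiberDim_le_card_mul π hU y F)
    _ = _ := by simp

variable [CompactSpace X] [TopologicalSpace Y] [T2Space Y] [BorelSpace Y]

theorem measurable_fiberDim_cast (hπ : Continuous π) {U : Set (Set X)} (hU : IsFinOpenCover U)
    (F : Finset Γ) : Measurable fun y => (fiberDim π U y F : ℝ≥0∞) :=
  measurable_from_top.comp (measurable_fiberDim hπ hU F)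

variable [MulAction Γ Y] [ContinuousConstSMul Γ Y]

theorem isSubadditiveInvariant_coverDimGiven (hπ : IsFactorMap Γ π) {ν : Measure Y}
    (hν : ν ∈ invariantProbabilities Γ Y) {U : Set (Set X)} (hU : IsFinOpenCover U) :
    IsSubadditiveInvariant (fun F : Finset Γ => (coverDimGiven π ν (coverPow U F)).toReal)
      U.ncard := by
  have := hν.1
  have hfin : ∀ F : Finset Γ, coverDimGiven π ν (coverPow U F) ≠ ⊤ := fun F =>
    ne_top_of_le_ne_top (ENNReal.natCast_ne_top _) (coverDimGiven_coverPow_le ν hU F)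
  refine ⟨fun F => ENNReal.toReal_nonneg, fun E F F' h => ?_, fun F s => ?_, fun F => ?_⟩
  · rw [← ENNReal.toReal_add (hfin F) (hfin F')]
    refine ENNReal.toReal_mono (ENNReal.add_ne_top.2 ⟨hfin F, hfin F'⟩) ?_
    simp only [coverDimGiven_coverPow]
    rw [← lintegral_add_left (measurable_fiberDim_cast hπ.continuous hU F)]
    exact lintegral_mono fun y => 
      (Nat.mono_cast (fiberDim_le_add π hU y h)).trans (Nat.cast_add _ _).le
  · congr 1
    simp only [coverDimGiven_coverPow]
    conv_rhs => rw [← hν.2 s]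
    rw [lintegral_map (measurable_fiberDim_cast hπ.continuous hU F)
      (continuous_const_smul s).measurable]
    refine lintegral_congr fun y => ?_
    rw [fiberDim_translate hπ.equivariant hU]
  · have := ENNReal.toReal_mono (ENNReal.natCast_ne_top _)
      (coverDimGiven_coverPow_le (π := π) ν hU F)
    rw [ENNReal.toReal_natCast] at this
    push_cast at this
    linarith

theorem exists_tendsto_avgDimGiven (hπ : IsFactorMap Γ π) {ν : Measure Y}
    (hν : ν ∈ invariantProbabilities Γ Y) {U : Set (Set X)} (hU : IsFinOpenCover U) :
    ∃ c : ℝ≥0, Tendsto (fun E : Finset Γ => avgDimGiven π ν U E) (invFilter Γ)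
      (𝓝 (c : ℝ≥0∞)) := by
  have := hν.1
  obtain ⟨c, hc⟩ := (isSubadditiveInvariant_coverDimGiven hπ hν hU).exists_tendsto
  refine ⟨c.toNNReal, (ENNReal.tendsto_ofReal hc).congr' ?_⟩
  -- Only the nonemptiness of `E` is extracted here.
  filter_upwards [almostInvariant_mem_invFilter (Finset.singleton_nonempty (1 : Γ)) one_pos]
    with E hE
  have hpos : (0 : ℝ) < E.card := by exact_mod_cast hE.1.card_pos
  rw [ENNReal.ofReal_div_of_pos hpos, ENNReal.ofReal_natCast, ENNReal.ofReal_toReal]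
  · rfl
  · exact ne_top_of_le_ne_top (ENNReal.natCast_ne_top _) (coverDimGiven_coverPow_le ν hU E)

/-- The mean dimension given `ν` is at most the largest mean dimension of a fibre. -/
theorem mdimGiven_le_iSup_mdimSubset (hπ : IsFactorMap Γ π) {F : ℕ → Finset Γ}
    (hF : IsFolnerSeq F) {ν : Measure Y} (hν : ν ∈ invariantProbabilities Γ Y) :
    mdimGiven Γ π ν ≤ ⨆ y : Y, mdimSubset F (π ⁻¹' {y}) := by
  have := hν.1
  refine iSup₂_le fun U hU => ?_
  have hFt := hF.tendsto_invFilter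
  have : (invFilter Γ).NeBot := neBot_of_le hFt
  obtain ⟨c, hc⟩ := exists_tendsto_avgDimGiven hπ hν hU
  rw [hc.limUnder_eq, ← (hc.comp hFt).limsup_eq]
  have hcard : ∀ n, ((F n).card : ℝ≥0∞) ≠ 0 := fun n => by
    exact_mod_cast (hF.nonempty n).card_pos.ne'
  calc limsup ((fun E : Finset Γ => avgDimGiven π ν U E) ∘ F) atTop
      = limsup (fun n => ∫⁻ y, (fiberDim π U y (F n) : ℝ≥0∞) / (F n).card ∂ν) atTop := by
        congr 1
        ext n
        simp only [div_eq_mul_inv]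
        rw [lintegral_mul_const _ (measurable_fiberDim_cast hπ.continuous hU _)]
        rfl
    _ ≤ ∫⁻ y, limsup (fun n => (fiberDim π U y (F n) : ℝ≥0∞) / (F n).card) atTop ∂ν := by
        refine limsup_lintegral_le (fun _ => (U.ncard : ℝ≥0∞)) (fun n => ?_)
          (fun n => Eventually.of_forall fun y => ?_) (by simp)
        · exact (measurable_fiberDim_cast hπ.continuous hU _).div_const _
        · refine ENNReal.div_le_of_le_mul ?_
          rw [mul_comm]
          exact (Nat.mono_cast (fiberDim_le_card_mul π hU y (F n))).trans (Nat.cast_mul _ _).le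
    _ ≤ ∫⁻ _, (⨆ y : Y, mdimSubset F (π ⁻¹' {y})) ∂ν := by
        refine lintegral_mono fun y => le_iSup_of_le y ?_
        exact le_iSup₂_of_le (f := fun (U : Set (Set X)) (_ : IsFinOpenCover U) =>
          limsup (fun n => (coverDim (restrict (coverPow U (F n)) (π ⁻¹' {y})) : ℝ≥0∞) /
            ((F n).card : ℝ≥0∞)) atTop) U hU le_rfl
    _ = _ := by simp

end Limit

/-! ### Averaging over a tiling -/

section Tiling

variable {Γ X Y : Type*} [CommGroup Γ] [TopologicalSpace X] [TopologicalSpace.MetrizableSpace X]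
  [MulAction Γ X] [ContinuousConstSMul Γ X] [MulAction Γ Y] {π : X → Y}

/-- For each `t ∈ T` the sets `T c` with `c * t⁻¹ ∈ C` again tile the group. A tile meeting `E`
outside the `T⁻¹`-boundary `D` has its centre in `E`, so the tiles centred in `E` cover `E \ D`. In
the sum over `t`, each centre `c` occurs at most once, and all reference to `C` disappears. -/
theorem card_mul_fiberDim_le [DecidableEq Γ] (hπ : ∀ (s : Γ) (x : X), π (s • x) = s • π x)
    {U : Set (Set X)} (hU : IsFinOpenCover U) (y : Y) {T : Finset Γ} (hT : IsTile T)
    (E : Finset Γ) :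
    T.card * fiberDim π U y E ≤ ∑ c ∈ E, fiberDim π U (c • y) T +
      T.card * ((E.filter fun g => ∃ k ∈ T.image (·⁻¹), k * g ∉ E).card * U.ncard) := by
  classical
  obtain ⟨C, hdisj, hcov⟩ := hT
  set D := E.filter fun g => ∃ k ∈ T.image (·⁻¹), k * g ∉ E with hD
  have hstep : ∀ t ∈ T, fiberDim π U y E ≤
      ∑ c ∈ E, (if c * t⁻¹ ∈ C then fiberDim π U (c • y) T else 0) + D.card * U.ncard := by
    intro t ht
    refine (fiberDim_le_add π hU y (F := E \ D) (F' := D) fun s hs => ?_).trans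
      (add_le_add ?_ (fiberDim_le_card_mul π hU y D))
    · by_cases h : s ∈ D
      · exact Or.inr h
      · exact Or.inl (Finset.mem_sdiff.2 ⟨hs, h⟩)
    · rw [← Finset.sum_filter]
      refine (fiberDim_le_sum π hU y (E.filter fun c => c * t⁻¹ ∈ C)
        (fun c => T.map (mulRightEmbedding c)) (E \ D) fun g hg => ?_).trans
        (Finset.sum_le_sum fun c _ => (fiberDim_translate hπ hU y T c).le)
      obtain ⟨hgE, hgD⟩ := Finset.mem_sdiff.1 hg
      have hmem : g * t⁻¹ ∈ ⋃ c ∈ C, (fun t => t * c) '' (T : Set Γ) := hcov ▸ Set.mem_univ _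
      simp only [Set.mem_iUnion] at hmem
      obtain ⟨c, hc, τ, hτ, hτc⟩ := hmem
      have hg' : g = τ * (c * t) := by
        rw [← mul_assoc]
        exact (mul_inv_eq_iff_eq_mul.1 hτc.symm)
      refine ⟨c * t, Finset.mem_filter.2 ⟨?_, by simpa using hc⟩,
        Finset.mem_map.2 ⟨τ, hτ, hg'.symm⟩⟩
      by_contra hcE
      refine hgD (Finset.mem_filter.2 ⟨hgE, τ⁻¹, Finset.mem_image_of_mem _ hτ, ?_⟩)
      rwa [hg', inv_mul_cancel_left]
  have huniq : ∀ c ∈ E, ∑ t ∈ T, (if c * t⁻¹ ∈ C then fiberDim π U (c • y) T else 0) ≤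
      fiberDim π U (c • y) T := by
    intro c _
    rw [← Finset.sum_filter, Finset.sum_const, smul_eq_mul]
    have hone : (T.filter fun t => c * t⁻¹ ∈ C).card ≤ 1 := by
      refine Finset.card_le_one.2 fun t ht t' ht' => ?_
      obtain ⟨htT, htC⟩ := Finset.mem_filter.1 ht
      obtain ⟨htT', htC'⟩ := Finset.mem_filter.1 ht'
      -- Commutativity enters here: `t * (c * t⁻¹) = c`, so `c` lies in both tiles `T (c t⁻¹)` and
      -- `T (c t'⁻¹)`, which must then coincide.
      have heq : c * t⁻¹ = c * t'⁻¹ := by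
        refine hdisj.elim_set htC htC' c ⟨t, htT, ?_⟩ ⟨t', htT', ?_⟩
        · simp
        · simp
      simpa using heq
    calc _ ≤ 1 * fiberDim π U (c • y) T := Nat.mul_le_mul_right _ hone
      _ = _ := one_mul _
  calc T.card * fiberDim π U y E = ∑ t ∈ T, fiberDim π U y E := by
        rw [Finset.sum_const, smul_eq_mul]
    _ ≤ ∑ t ∈ T, (∑ c ∈ E, (if c * t⁻¹ ∈ C then fiberDim π U (c • y) T else 0) +
          D.card * U.ncard) := Finset.sum_le_sum hstep
    _ = ∑ c ∈ E, ∑ t ∈ T, (if c * t⁻¹ ∈ C then fiberDim π U (c • y) T else 0) +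
          T.card * (D.card * U.ncard) := by
        rw [Finset.sum_add_distrib, Finset.sum_comm, Finset.sum_const, smul_eq_mul]
    _ ≤ _ := Nat.add_le_add_right (Finset.sum_le_sum huniq) _

end Tiling

/-! ### Empirical measures -/

section Empirical

variable {Γ Y : Type*} [Group Γ] [MulAction Γ Y] [MeasurableSpace Y]

/-- The uniform distribution on the points `t • y`, `t ∈ E`. -/
noncomputable def empiricalMeasure (E : Finset Γ) (y : Y) : Measure Y :=
  (E.card : ℝ≥0∞)⁻¹ • ∑ t ∈ E, Measure.dirac (t • y)

theorem isProbabilityMeasure_empiricalMeasure {E : Finset Γ} (hE : E.Nonempty) (y : Y) :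
    IsProbabilityMeasure (empiricalMeasure E y) := by
  constructor
  have : (E.card : ℝ≥0∞) ≠ 0 := by exact_mod_cast hE.card_pos.ne'
  simp [empiricalMeasure, Measure.finsetSum_apply,
    ENNReal.inv_mul_cancel this (ENNReal.natCast_ne_top _)]

theorem lintegral_empiricalMeasure (E : Finset Γ) (y : Y) {f : Y → ℝ≥0∞} (hf : Measurable f) :
    ∫⁻ z, f z ∂(empiricalMeasure E y) = (E.card : ℝ≥0∞)⁻¹ * ∑ t ∈ E, f (t • y) := by
  simp [empiricalMeasure, lintegral_smul_measure, lintegral_finsetSum_measure,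
    lintegral_dirac' _ hf]

variable [TopologicalSpace Y] [BorelSpace Y]

theorem integral_empiricalMeasure (E : Finset Γ) (y : Y) (f : BoundedContinuousFunction Y ℝ) :
    ∫ z, f z ∂(empiricalMeasure E y) = (∑ t ∈ E, f (t • y)) / E.card := by
  have hf : StronglyMeasurable f := f.continuous.stronglyMeasurable
  rw [empiricalMeasure, integral_smul_measure, integral_finsetSum_measure]
  · simp [integral_dirac' _ _ hf, div_eq_inv_mul]
  · intro t _
    exact f.integrable _

/-- Pushing forward by `s` replaces the sum over `E` by the sum over `s E`; the common points
cancel. -/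
theorem abs_integral_map_empiricalMeasure_sub_le [ContinuousConstSMul Γ Y] (E : Finset Γ) (y : Y)
    (s : Γ) (f : BoundedContinuousFunction Y ℝ) :
    |∫ z, f z ∂((empiricalMeasure E y).map fun z => s • z) - ∫ z, f z ∂(empiricalMeasure E y)| ≤
      ‖f‖ * (((symmDiff ((fun t => s * t) '' (E : Set Γ)) (E : Set Γ)).ncard : ℝ) / E.card) := by
  classical
  have hmap : ∫ z, f z ∂((empiricalMeasure E y).map fun z => s • z) =
      (∑ t ∈ E.image fun t => s * t, f (t • y)) / E.card := by
    rw [integral_map (continuous_const_smul s).aemeasurable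
      f.continuous.stronglyMeasurable.aestronglyMeasurable]
    have h := integral_empiricalMeasure E y
      (f.compContinuous ⟨fun z => s • z, continuous_const_smul s⟩)
    simp only [BoundedContinuousFunction.compContinuous_apply, ContinuousMap.coe_mk] at h
    rw [h, Finset.sum_image fun t _ t' _ h => mul_left_cancel h]
    simp [mul_smul]
  rw [hmap, integral_empiricalMeasure, ← sub_div, abs_div, Nat.abs_cast, ← mul_div_assoc]
  refine div_le_div_of_nonneg_right ?_ (Nat.cast_nonneg _)
  rw [← Finset.sum_sdiff_sub_sum_sdiff]
  have hset : symmDiff ((fun t => s * t) '' (E : Set Γ)) (E : Set Γ) =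
      ((E.image (fun t => s * t) \ E ∪ E \ E.image (fun t => s * t) : Finset Γ) : Set Γ) := by
    simp [Set.symmDiff_def]
  rw [hset, Set.ncard_coe_finset, Finset.card_union_of_disjoint disjoint_sdiff_sdiff]
  have hb : ∀ S : Finset Γ, |∑ t ∈ S, f (t • y)| ≤ S.card * ‖f‖ := fun S => by
    refine (Finset.abs_sum_le_sum_abs _ _).trans ?_
    rw [← nsmul_eq_mul]
    exact Finset.sum_le_card_nsmul _ _ _ fun t _ => f.norm_coe_le_norm _
  refine (abs_sub _ _).trans ((add_le_add (hb _) (hb _)).trans (le_of_eq ?_))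
  push_cast
  ring

end Empirical

/-! ### Upper semicontinuity of the integral -/

/-- Integrals of bounded upper semicontinuous functions with natural values are upper
semicontinuous for weak convergence. -/
theorem eventually_lintegral_le_of_isOpen_le {Y ι : Type*} [TopologicalSpace Y] [MeasurableSpace Y]
    [BorelSpace Y] [HasOuterApproxClosed Y] {L : Filter ι} {μ : ι → ProbabilityMeasure Y}
    {ν : ProbabilityMeasure Y} (h : Tendsto μ L (𝓝 ν)) {f : Y → ℕ} {N : ℕ} (hN : ∀ y, f y ≤ N)
    (hf : ∀ k, IsOpen {y | f y ≤ k}) {ε : ℝ≥0∞} (hε : ε ≠ 0) :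
    ∀ᶠ i in L, ∫⁻ y, (f y : ℝ≥0∞) ∂(μ i : Measure Y) ≤
      ∫⁻ y, (f y : ℝ≥0∞) ∂(ν : Measure Y) + N * ε := by
  have hclosed : ∀ k, IsClosed {y | k < f y} := fun k => by
    have : {y | k < f y} = {y | f y ≤ k}ᶜ := by
      ext y
      simp
    rw [this]
    exact (hf k).isClosed_compl
  -- Layer-cake formula: the integral is a sum of the measures of `N` closed sets, and the
  -- portmanteau theorem applies to each at cost `ε`.
  have hlayer : ∀ m : Measure Y, ∫⁻ y, (f y : ℝ≥0∞) ∂m = ∑ k ∈ Finset.range N, m {y | k < f y} := by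
    intro m
    have hfy : ∀ y, (f y : ℝ≥0∞) =
        ∑ k ∈ Finset.range N, ({y | k < f y} : Set Y).indicator (fun _ => (1 : ℝ≥0∞)) y := by
      intro y
      have h1 : (Finset.range N).filter (fun k => k < f y) = Finset.range (f y) := by
        ext k
        have := hN y
        simp only [Finset.mem_filter, Finset.mem_range]
        omega
      simp [Set.indicator_apply, Finset.sum_boole, h1]
    simp_rw [hfy]
    rw [lintegral_finsetSum _ fun k _ => measurable_const.indicator (hclosed k).measurableSet]
    refine Finset.sum_congr rfl fun k _ => ?_
    rw [lintegral_indicator_const (hclosed k).measurableSet, one_mul]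
  have hev : ∀ k ∈ Finset.range N, ∀ᶠ i in L,
      (μ i : Measure Y) {y | k < f y} ≤ (ν : Measure Y) {y | k < f y} + ε := by
    intro k _
    have hlim := ProbabilityMeasure.limsup_measure_closed_le_of_tendsto h (hclosed k)
    have hlt := hlim.trans_lt (ENNReal.lt_add_right (measure_ne_top (ν : Measure Y) _) hε)
    exact (eventually_lt_of_limsup_lt hlt).mono fun i hi => hi.le
  filter_upwards [(Finset.eventually_all _).2 hev] with i hi
  rw [hlayer, hlayer]
  calc ∑ k ∈ Finset.range N, (μ i : Measure Y) {y | k < f y}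
      ≤ ∑ k ∈ Finset.range N, ((ν : Measure Y) {y | k < f y} + ε) := Finset.sum_le_sum hi
    _ = _ := by simp [Finset.sum_add_distrib]

/-! ### The variational principle -/

section Variational

variable {Γ X Y : Type*} [CommGroup Γ] [TopologicalSpace X] [CompactSpace X]
  [TopologicalSpace.MetrizableSpace X] [TopologicalSpace Y] [TopologicalSpace.MetrizableSpace Y]
  [MeasurableSpace Y] [BorelSpace Y] [MulAction Γ X] [ContinuousConstSMul Γ X] [MulAction Γ Y]
  {π : X → Y}

/-- Weak limits of empirical measures along a Følner sequence are invariant. -/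
theorem map_eq_of_tendsto_empiricalMeasure {Γ Y : Type*} [Group Γ] [MulAction Γ Y]
    [TopologicalSpace Y] [TopologicalSpace.MetrizableSpace Y] [MeasurableSpace Y] [BorelSpace Y]
    [ContinuousConstSMul Γ Y] {F : ℕ → Finset Γ} (hF : IsFolnerSeq F) (y : Y) {L : Filter ℕ}
    [L.NeBot] (hL : L ≤ atTop) {μ : ℕ → ProbabilityMeasure Y}
    (hμ : ∀ n, (μ n : Measure Y) = empiricalMeasure (F n) y) {ν : ProbabilityMeasure Y}
    (h : Tendsto μ L (𝓝 ν)) (s : Γ) : (ν : Measure Y).map (fun z => s • z) = ν := by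
  have hs : Continuous fun z : Y => s • z := continuous_const_smul s
  have h1 := ProbabilityMeasure.tendsto_map_of_tendsto_of_continuous μ ν h hs
  have h2 : Tendsto (fun n => (μ n).map hs.aemeasurable) L (𝓝 ν) := by
    rw [ProbabilityMeasure.tendsto_iff_forall_integral_tendsto]
    intro f
    have hf := ProbabilityMeasure.tendsto_iff_forall_integral_tendsto.1 h f
    have hd : Tendsto (fun n => ∫ z, f z ∂((μ n).map hs.aemeasurable : Measure Y) -
        ∫ z, f z ∂(μ n : Measure Y)) L (𝓝 0) := by
      have hb := ((hF.tendsto s).mono_left hL).const_mul ‖f‖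
      rw [mul_zero] at hb
      refine squeeze_zero_norm (fun n => ?_) hb
      rw [ProbabilityMeasure.toMeasure_map, hμ, Real.norm_eq_abs]
      exact abs_integral_map_empiricalMeasure_sub_le (F n) y s f
    simpa using hd.add hf
  have := tendsto_nhds_unique h1 h2
  rw [← ProbabilityMeasure.toMeasure_map ν hs.aemeasurable, this]

/-- The average dimension of a fibre along an almost invariant set is controlled by the integral
of the dimension over a tile against the empirical measure. -/
theorem fiberDim_div_card_le (hπ : IsFactorMap Γ π) {U : Set (Set X)} (hU : IsFinOpenCover U)
    (y : Y) {T : Finset Γ} (hT : IsTile T) (hTne : T.Nonempty) [DecidableEq Γ] {E : Finset Γ}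
    {δ : ℝ≥0} (hE : E ∈ almostInvariant (T.image (·⁻¹)) δ) :
    (fiberDim π U y E : ℝ≥0∞) / E.card ≤
      (∫⁻ z, (fiberDim π U z T : ℝ≥0∞) ∂(empiricalMeasure E y)) / T.card + δ * U.ncard := by
  obtain ⟨hEne, hbd⟩ := mem_almostInvariant_iff.1 hE
  set D := E.filter fun g => ∃ k ∈ T.image (·⁻¹), k * g ∉ E
  have hbd' : (D.card : ℝ≥0∞) ≤ δ * E.card := by exact_mod_cast hbd
  have hE0 : (E.card : ℝ≥0∞) ≠ 0 := by exact_mod_cast hEne.card_pos.ne'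
  have hT0 : (T.card : ℝ≥0∞) ≠ 0 := by exact_mod_cast hTne.card_pos.ne'
  have hEt : (E.card : ℝ≥0∞) ≠ ⊤ := ENNReal.natCast_ne_top _
  have hTt : (T.card : ℝ≥0∞) ≠ ⊤ := ENNReal.natCast_ne_top _
  have hmain : (T.card : ℝ≥0∞) * fiberDim π U y E ≤
      ∑ c ∈ E, (fiberDim π U (c • y) T : ℝ≥0∞) + T.card * (D.card * U.ncard) := by
    exact_mod_cast card_mul_fiberDim_le hπ.equivariant hU y hT E
  rw [lintegral_empiricalMeasure E y (measurable_fiberDim_cast hπ.continuous hU T)]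
  set S := ∑ c ∈ E, (fiberDim π U (c • y) T : ℝ≥0∞)
  refine ENNReal.div_le_of_le_mul ?_
  refine (ENNReal.mul_le_mul_iff_right hT0 hTt).1 (hmain.trans ?_)
  calc S + T.card * (D.card * U.ncard) ≤ S + T.card * ((δ * E.card) * U.ncard) := by gcongr
    _ = T.card * (((E.card : ℝ≥0∞)⁻¹ * S / T.card + δ * U.ncard) * E.card) := by
      have h1 : (E.card : ℝ≥0∞)⁻¹ * E.card = 1 := ENNReal.inv_mul_cancel hE0 hEt
      have h2 : (T.card : ℝ≥0∞)⁻¹ * T.card = 1 := ENNReal.inv_mul_cancel hT0 hTt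
      calc S + T.card * ((δ * E.card) * U.ncard)
          = ((E.card : ℝ≥0∞)⁻¹ * E.card) * ((T.card : ℝ≥0∞)⁻¹ * T.card) * S
            + T.card * ((δ * E.card) * U.ncard) := by rw [h1, h2, one_mul, one_mul]
        _ = _ := by rw [div_eq_mul_inv]; ring

/-- The growth of the dimension of a fibre is realised by an invariant measure. -/
theorem exists_invariant_le_avgDimGiven [CompactSpace Y] [ContinuousConstSMul Γ Y]
    (hπ : IsFactorMap Γ π) {F : ℕ → Finset Γ}
    (hF : IsTilingFolnerSeq F) {U : Set (Set X)} (hU : IsFinOpenCover U) (y : Y) {ℓ : ℝ≥0∞}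
    (hℓ : ℓ < limsup (fun n => (fiberDim π U y (F n) : ℝ≥0∞) / (F n).card) atTop) :
    ∃ ν ∈ invariantProbabilities Γ Y, ∀ m, ℓ ≤ avgDimGiven π ν U (F m) := by
  classical
  have hfreq : ∃ᶠ n in atTop, ℓ < (fiberDim π U y (F n) : ℝ≥0∞) / (F n).card :=
    frequently_lt_of_lt_limsup (by isBoundedDefault) hℓ
  -- An ultrafilter on the indices where `ℓ` is exceeded plays the role of a convergent subsequence.
  obtain ⟨L, hLne, hL⟩ : ∃ L : Ultrafilter ℕ, (L : Filter ℕ) ≤ atTop ∧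
      ∀ᶠ n in (L : Filter ℕ), ℓ < (fiberDim π U y (F n) : ℝ≥0∞) / (F n).card := by
    have : (atTop ⊓ 𝓟 {n | ℓ < (fiberDim π U y (F n) : ℝ≥0∞) / (F n).card}).NeBot :=
      frequently_mem_iff_neBot.1 hfreq
    have hle := Ultrafilter.of_le
      (atTop ⊓ 𝓟 {n | ℓ < (fiberDim π U y (F n) : ℝ≥0∞) / (F n).card})
    exact ⟨Ultrafilter.of _, hle.trans inf_le_left, hle (mem_inf_of_right (mem_principal_self _))⟩
  let μ : ℕ → ProbabilityMeasure Y := fun n =>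
    ⟨empiricalMeasure (F n) y, isProbabilityMeasure_empiricalMeasure (hF.nonempty n) y⟩
  obtain ⟨ν, -, hν⟩ := isCompact_univ.ultrafilter_le_nhds (L.map μ) (by simp)
  have hμν : Tendsto μ L (𝓝 ν) := hν
  refine ⟨ν, ⟨inferInstance, fun s => map_eq_of_tendsto_empiricalMeasure hF.toIsFolnerSeq y hLne
    (fun n => rfl) hμν s⟩, fun m => ?_⟩
  set T := F m with hTdef
  have hTne : T.Nonempty := hF.nonempty m
  have hT0 : (T.card : ℝ≥0∞) ≠ 0 := by exact_mod_cast hTne.card_pos.ne'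
  refine ENNReal.le_of_forall_pos_le_add fun ε hε _ => ?_
  -- Two errors of size `δ #U` arise, one from the boundary of the tiling and one from
  -- semicontinuity; the `+ 1` keeps the denominator positive.
  set δ : ℝ≥0 := ε / (2 * U.ncard + 1) with hδdef
  have hδ : 0 < δ := by positivity
  have hev := eventually_lintegral_le_of_isOpen_le hμν
    (fun z => fiberDim_le_card_mul π hU z T) (isOpen_fiberDim_le hπ.continuous hU T)
    (ENNReal.coe_ne_zero.2 hδ.ne')
  have hinv : ∀ᶠ n in (L : Filter ℕ), F n ∈ almostInvariant (T.image (·⁻¹)) (δ : ℝ) :=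
    (hF.toIsFolnerSeq.tendsto_invFilter.mono_left hLne).eventually
      (almostInvariant_mem_invFilter (hTne.image _) (by exact_mod_cast hδ))
  obtain ⟨n, hn, hn', hn''⟩ := (hL.and (hev.and hinv)).exists
  have hδε : (δ : ℝ≥0∞) * U.ncard + δ * U.ncard ≤ ε := by
    have : δ * U.ncard + δ * U.ncard ≤ ε := by
      calc δ * U.ncard + δ * U.ncard ≤ δ * (2 * U.ncard + 1) := by
            rw [mul_add, mul_one, two_mul, mul_add]
            exact le_self_add
        _ = ε := div_mul_cancel₀ _ (by positivity)
    exact_mod_cast this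
  calc ℓ ≤ (fiberDim π U y (F n) : ℝ≥0∞) / (F n).card := hn.le
    _ ≤ (∫⁻ z, (fiberDim π U z T : ℝ≥0∞) ∂(μ n : Measure Y)) / T.card + δ * U.ncard :=
      fiberDim_div_card_le hπ hU y (hF.isTile m) hTne hn''
    _ ≤ (∫⁻ z, (fiberDim π U z T : ℝ≥0∞) ∂(ν : Measure Y) + (T.card * U.ncard : ℕ) * δ) / T.card
        + δ * U.ncard := by gcongr
    _ = avgDimGiven π ν U T + (δ * U.ncard + δ * U.ncard) := by
      have h1 : ((T.card * U.ncard : ℕ) * (δ : ℝ≥0∞)) / T.card = δ * U.ncard := by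
        push_cast
        rw [mul_assoc, mul_comm, ENNReal.mul_div_cancel_right hT0 (ENNReal.natCast_ne_top _),
          mul_comm]
      rw [ENNReal.add_div, h1, add_assoc]
      rfl
    _ ≤ avgDimGiven π ν U T + ε := by gcongr

end Variational

end MeanDim

/-- The first conjunct says that the limits in the definition of `mdim(X|ν)` exist and are finite;
the second one is the equality of the two suprema. -/
theorem proposition4p4 {Γ X Y : Type*} [CommGroup Γ] [Countable Γ]
    [TopologicalSpace X] [CompactSpace X] [TopologicalSpace.MetrizableSpace X]
    [TopologicalSpace Y] [CompactSpace Y] [TopologicalSpace.MetrizableSpace Y]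
    [MeasurableSpace Y] [BorelSpace Y]
    [MulAction Γ X] [ContinuousConstSMul Γ X] [MulAction Γ Y] [ContinuousConstSMul Γ Y]
    (π : X → Y) (hπ : MeanDim.IsFactorMap Γ π)
    (F : ℕ → Finset Γ) (hF : MeanDim.IsTilingFolnerSeq F) :
    (∀ ν ∈ MeanDim.invariantProbabilities Γ Y, ∀ U : Set (Set X), MeanDim.IsFinOpenCover U →
      ∃ c : ℝ≥0, Tendsto (fun E : Finset Γ => MeanDim.avgDimGiven π ν U E)
        (MeanDim.invFilter Γ) (𝓝 (c : ℝ≥0∞))) ∧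
    (⨆ ν ∈ MeanDim.invariantProbabilities Γ Y, MeanDim.mdimGiven Γ π ν) =
      (⨆ y : Y, MeanDim.mdimSubset F (π ⁻¹' {y})) := by
  refine ⟨fun ν hν U hU => MeanDim.exists_tendsto_avgDimGiven hπ hν hU, le_antisymm ?_ ?_⟩
  · exact iSup₂_le fun ν hν => MeanDim.mdimGiven_le_iSup_mdimSubset hπ hF.toIsFolnerSeq hν
  · refine iSup_le fun y => iSup₂_le fun U hU => le_of_forall_lt_imp_le_of_dense fun ℓ hℓ => ?_
    -- The measure may depend on `y`, `U` and `ℓ`, since it is only compared with the supremum over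
    -- all invariant measures.
    obtain ⟨ν, hν, h⟩ := MeanDim.exists_invariant_le_avgDimGiven hπ hF hU y hℓ
    obtain ⟨c, hc⟩ := MeanDim.exists_tendsto_avgDimGiven hπ hν hU
    have hFt := hF.toIsFolnerSeq.tendsto_invFilter
    have : (MeanDim.invFilter Γ).NeBot := neBot_of_le hFt
    refine le_iSup₂_of_le ν hν (le_iSup₂_of_le U hU ?_)
    rw [hc.limUnder_eq]
    exact ge_of_tendsto' (hc.comp hFt) h
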